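/- **Setting.** Let $H_{m,n}(y)$ ($m,n\ge 0$) be the generalized Hermite polynomials, determined by $2mH_{m+1,n}H_{m-1,n}=H_{m,n}H_{m,n}''-(H_{m,n}')^2+2mH_{m,n}^2$, $2nH_{m,n+1}H_{m,n-1}=-H_{m,n}H_{m,n}''+(H_{m,n}')^2+2nH_{m,n}^2$ and $H_{0,0}=H_{1,0}=H_{0,1}=1$, $H_{1,1}=2y$. Let $w^{(I)}_{m,n}(y)=\frac{d}{dy}\log\frac{H_{m+1,n}(y)}{H_{m,n}(y)}$ and $w^{(II)}_{m,n}(y)=-\frac{d}{dy}\log\frac{H_{m,n+1}(y)}{H_{m,n}(y)}$ be the associated rational Painlevé-IV functions of the first and second type. For $x\in\mathbb{C}$ and integers $m\ge n\ge 1$ put $r=m/n$ and $\theta(z;x,r)=(1-r)\log z-\frac{2r^{1/2}x}{z}+\frac1{z^2}$, and let $\mathbf N_{m,n}(z;x)$ denote the solution, when it exists, of the following Riemann–Hilbert problem: $\mathbf N_{m,n}$ is a $2\times2$ matrix, analytic in $z$ off the unit circle $C$ (oriented clockwise) with Hölder-continuous boundary values, which satisfy $\mathbf N_{m,n+}=\mathbf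 N_{m,n-}\begin{bmatrix}1&\frac1{2\pi i}e^{-n\theta(z;x,r)}\\0&1\end{bmatrix}$ on $C$ ($+$ is the left side, i.e. the exterior of the circle), and $\mathbf N_{m,n}(z;x)=(\mathbb I+O(z^{-1}))z^{n\sigma_3}$ as $z\to\infty$, where $\sigma_3=\mathrm{diag}(1,-1)$. Write $\mathbf N_{m,n}=\mathbf N_0(x)+\mathbf N_1(x)z+O(z^2)$ as $z\to0$ and $\mathbf N_{m,n}=\left(\mathbb I+\frac{\mathbf N_{-1}(x)}{z}+O(z^{-2})\right)z^{n\sigma_3}$ as $z\to\infty$. **Statement.** (a) Fix integers $p\ge q\ge1$, let $m=jp$, $n=jq$ with $j\in\mathbb N$, and fix $x$ in the pole-free region, that is, suppose that some fixed neighbourhood of $x$ contains, for all sufficiently large $j$, no pole of $x'\mapsto w^{(II)}_{m+1,n}((m+1)^{1/2}x')$ (no zero of $H_{m+1,n}((m+1)^{1/2}x')$ or $H_{m+1,n+1}((m+1)^{1/2}x')$). Then, as $j\to\infty$ (through those $j$ for which $\mathbf N_{m,n}(z;x)$ exists), $$\frac{1}{n^{1/2}}w^{(II)}_{m+1,n}\big((m+1)^{1/2}x\big)=\left(\frac{1}{n^{1/2}}w^{(I)}_{m,n}\big(m^{1/2}x\big)+\frac{2[\mathbf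 N_0]_{11}[\mathbf N_0]_{12}}{[\mathbf N_{-1}]_{12}}\right)\left(1+O\!\left(\frac1m\right)\right),$$ where for large $j$ the terms in the bracket are finite ($H_{m,n}$ and $H_{m+1,n}$ do not vanish at $m^{1/2}x$, and $[\mathbf N_{-1}]_{12}\ne0$) and the implied constant depends only on $p,q,x$. (b) For all integers $m\ge n\ge1$ and every $x\in\mathbb C$ such that $\mathbf N_{m,n}(z;x)$ exists and $H_{m+1,n}$, $H_{m+1,n+1}$ do not vanish at $m^{1/2}x$, one has $H_{m,n}(m^{1/2}x)\neq 0$, $[\mathbf N_{-1}]_{12}\ne0$ and, exactly, $$\frac{1}{n^{1/2}}w^{(II)}_{m+1,n}\big(m^{1/2}x\big)=\frac{1}{n^{1/2}}w^{(I)}_{m,n}\big(m^{1/2}x\big)+\frac{2[\mathbf N_0]_{11}[\mathbf N_0]_{12}}{[\mathbf N_{-1}]_{12}}.$$ -/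

import Mathlib

open Polynomial Filter Topology Asymptotics
open scoped NNReal

noncomputable section

/-- The sequence of polynomials `f_0 = a`, `f_1 = b` generated by
`2 n f_{n+1} f_{n-1} = -f_n f_n'' + (f_n')^2 + 2 n f_n^2`, `n ≥ 1`, solved for `f_{n+1}`
(the division of polynomials is exact in the cases `a = b = 1` and `a = 1`, `b = 2y` used below). -/
def hermiteColumn (a b : ℂ[X]) : ℕ → ℂ[X]
  | 0 => a
  | 1 => b
  | n + 2 =>
    let f := hermiteColumn a b (n + 1)
    C ((2 * ((n : ℂ) + 1))⁻¹) *
      ((-(f * derivative (derivative f)) + derivative f ^ 2 + C (2 * ((n : ℂ) + 1)) * f ^ 2)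
        / hermiteColumn a b n)

/-- The generalized Hermite polynomials `H_{m,n}`, computed from
`H_{0,0} = H_{1,0} = H_{0,1} = 1`, `H_{1,1} = 2y` with the two recurrence relations
`2 m H_{m+1,n} H_{m-1,n} = H_{m,n} H_{m,n}'' - (H_{m,n}')^2 + 2 m H_{m,n}^2` and
`2 n H_{m,n+1} H_{m,n-1} = -H_{m,n} H_{m,n}'' + (H_{m,n}')^2 + 2 n H_{m,n}^2`:
the second one gives the columns `m = 0` and `m = 1`, the first one all the others
(each time the division of polynomials is exact). -/
def genHermite : ℕ → ℕ → ℂ[X]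
  | 0, n => hermiteColumn 1 1 n
  | 1, n => hermiteColumn 1 (C 2 * X) n
  | m + 2, n =>
    let f := genHermite (m + 1) n
    C ((2 * ((m : ℂ) + 1))⁻¹) *
      ((f * derivative (derivative f) - derivative f ^ 2 + C (2 * ((m : ℂ) + 1)) * f ^ 2)
        / genHermite m n)

/-- The rational Painlevé-IV function of the first type,
`w^{(I)}_{m,n}(y) = d/dy log (H_{m+1,n}(y) / H_{m,n}(y))`. -/
def wI (m n : ℕ) (y : ℂ) : ℂ :=
  logDeriv (fun t : ℂ => (genHermite (m + 1) n).eval t / (genHermite m n).eval t) y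

/-- The rational Painlevé-IV function of the second type,
`w^{(II)}_{m,n}(y) = - d/dy log (H_{m,n+1}(y) / H_{m,n}(y))`. -/
def wII (m n : ℕ) (y : ℂ) : ℂ :=
  -logDeriv (fun t : ℂ => (genHermite m (n + 1)).eval t / (genHermite m n).eval t) y

/-- The positive square root of a natural number, as a complex number. -/
def sqrtN (k : ℕ) : ℂ := ((Real.sqrt (k : ℝ) : ℝ) : ℂ)

/-- `θ(z;x,r) = (1 - r) log z - 2 r^{1/2} x / z + 1 / z^2`. -/
def theta (r : ℝ) (x z : ℂ) : ℂ :=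
  (1 - (r : ℂ)) * Complex.log z - 2 * ((Real.sqrt r : ℝ) : ℂ) * x / z + 1 / z ^ 2

/-- The jump matrix on the unit circle, with `r = m / n`. The factor `exp (-n (1 - r) log z)` is
`z ^ (m - n)`, so that the branch of the logarithm is irrelevant. -/
def jumpMatrix (m n : ℕ) (x z : ℂ) : Matrix (Fin 2) (Fin 2) ℂ :=
  !![1, 1 / (2 * (Real.pi : ℂ) * Complex.I) *
        Complex.exp (-(n : ℂ) * theta ((m : ℝ) / (n : ℝ)) x z);
     0, 1]

/-- `z^{-n σ₃}`. -/
def zPowNegSigma (n : ℕ) (z : ℂ) : Matrix (Fin 2) (Fin 2) ℂ :=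
  !![(z ^ n)⁻¹, 0; 0, z ^ n]

/-- `N` solves the Riemann-Hilbert problem of the scaled orthogonal polynomials. The contour is the
unit circle oriented clockwise, so its left (`+`) side is the exterior of the disc and its
right (`-`) side is the interior. -/
structure IsRHPSolution (m n : ℕ) (x : ℂ) (N : ℂ → Matrix (Fin 2) (Fin 2) ℂ) : Prop where
  analytic : ∀ i j, DifferentiableOn ℂ (fun z => N z i j) (Metric.sphere (0 : ℂ) 1)ᶜ
  jump : ∃ Np Nm : ℂ → Matrix (Fin 2) (Fin 2) ℂ,
    (∃ K α : ℝ≥0, 0 < α ∧ ∀ i j,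
      HolderOnWith K α (fun z => Np z i j) (Metric.sphere (0 : ℂ) 1) ∧
      HolderOnWith K α (fun z => Nm z i j) (Metric.sphere (0 : ℂ) 1)) ∧
    (∀ ζ ∈ Metric.sphere (0 : ℂ) 1, ∀ i j,
      Tendsto (fun z => N z i j) (𝓝[{z : ℂ | 1 < ‖z‖}] ζ) (𝓝 (Np ζ i j)) ∧
      Tendsto (fun z => N z i j) (𝓝[{z : ℂ | ‖z‖ < 1}] ζ) (𝓝 (Nm ζ i j))) ∧
    ∀ ζ ∈ Metric.sphere (0 : ℂ) 1, Np ζ = Nm ζ * jumpMatrix m n x ζ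
  normalized : ∀ i j,
    (fun z => (N z * zPowNegSigma n z - 1) i j) =O[Bornology.cobounded ℂ] (fun z : ℂ => z⁻¹)

/-- `N(z) = N₀ + N₁ z + O(z^2)` as `z → 0`. -/
def ExpandsAtZero (N : ℂ → Matrix (Fin 2) (Fin 2) ℂ) (N₀ N₁ : Matrix (Fin 2) (Fin 2) ℂ) : Prop :=
  ∀ i j, (fun z : ℂ => (N z - N₀ - z • N₁) i j) =O[𝓝 0] (fun z : ℂ => z ^ 2)

/-- `N(z) = (1 + N₋₁ / z + O(1 / z^2)) z^{n σ₃}` as `z → ∞`. -/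
def ExpandsAtInfinity (n : ℕ) (N : ℂ → Matrix (Fin 2) (Fin 2) ℂ)
    (Nminus : Matrix (Fin 2) (Fin 2) ℂ) : Prop :=
  ∀ i j, (fun z : ℂ => (N z * zPowNegSigma n z - 1 - z⁻¹ • Nminus) i j)
    =O[Bornology.cobounded ℂ] (fun z : ℂ => (z ^ 2)⁻¹)

/-- `x` lies in the pole-free region for the ratio `p / q`: some fixed neighbourhood of `x` contains,
for all large `j` and with `m = j p`, `n = j q`, no pole of the scaled function
`x' ↦ w^{(II)}_{m+1,n}((m+1)^{1/2} x')`, that is, no zero of the polynomials `H_{m+1,n}` and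
`H_{m+1,n+1}` evaluated at `(m+1)^{1/2} x'`. -/
def InPoleFreeRegion (p q : ℕ) (x : ℂ) : Prop :=
  ∃ δ : ℝ, 0 < δ ∧ ∀ᶠ j : ℕ in atTop, ∀ x' ∈ Metric.ball x δ,
    (genHermite (j * p + 1) (j * q)).eval (sqrtN (j * p + 1) * x') ≠ 0 ∧
    (genHermite (j * p + 1) (j * q + 1)).eval (sqrtN (j * p + 1) * x') ≠ 0

end

set_option linter.unusedSectionVars false

/-! Everything is expressed through the Toeplitz determinants τ_{m,n} = det (h_{m-i+j}) of size n
(`hermiteDet`), where h_k = H_k / k! are the Taylor coefficients of exp (2ys - s²). The rules h_k' =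
2 h_{k-1} and k h_k = 2y h_{k-1} - 2 h_{k-2}, combined with the Plücker relation, give bilinear
identities between neighbouring τ (the `wronskian_*` lemmas). Toda equations follow by induction and
identify H_{m,n} with τ_{m,n} up to a nonzero constant (`genHermite_eq`), which logarithmic
derivatives do not see.

Part (b): with y = m^{1/2} x the weight e^{-nθ} is z^{m-n} exp (2y n^{1/2}/z - n/z²), whose moments
on the circle are, up to powers of n^{1/2}, the values h_k(y). The first row of N consists of a
monic polynomial of degree n, orthogonal to 1, …, z^{n-1}, and a function whose jump is that
polynomial times the weight. Cramer's rule therefore gives the three relevant entries as ratios of τ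
(`IsRHPSolution.entries`), and the last term of the bracket becomes -2 n^{-1/2} τ_{m+1,n} τ_{m,n+1}
/ (τ_{m,n} τ_{m+1,n+1}). By `wronskian_diag` this is n^{-1/2} (w^{II}_{m+1,n} - w^{I}_{m,n}).

Part (a): after (b) it remains to compare one function at two arguments, which after rescaling are
at distance O(1/m). The rescaled function g satisfies g g'' - g'²/2 = M² p(t, g), where M = m + 1
and p is quartic in g with constant term -2 (Painlevé IV). Where g is holomorphic, Cauchy's
estimates control the left side, so for large M neither a large g (quartic term) nor a small g
(constant term) is possible. Hence g is bounded, bounded away from 0 and has bounded derivative on a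
fixed disc, uniformly in m, and its two values differ by a factor 1 + O(1/m)
(`exists_ratio_estimate`). -/

noncomputable section

/-! ### Determinants with two distinguished rows and the three-term Plücker relation. -/

section Brackets

variable {R : Type*} [CommRing R]

/-- The determinant of the matrix with the given rows. -/
def rowDet {N : ℕ} (v : Fin N → Fin N → R) : R := (Matrix.of v).det

/-- The determinant with first row `u`, last row `v`, and the rows `c` in between. -/
def bracket {n : ℕ} (c : Fin n → Fin (n + 2) → R) (u v : Fin (n + 2) → R) : R :=
  rowDet (Fin.cons u (Fin.snoc c v : Fin (n + 1) → Fin (n + 2) → R) :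
    Fin (n + 2) → Fin (n + 2) → R)

/-- Cramer's rule for rows: `det M • a` is the combination of the rows of `M` whose coefficients
are the determinants with one row replaced by `a`. -/
theorem det_smul_eq_sum_det_updateRow {N : ℕ} (M : Matrix (Fin N) (Fin N) R) (a : Fin N → R) :
    M.det • a = ∑ i, (M.updateRow i a).det • M i := by
  have h := Matrix.mulVec_cramer M.transpose a
  rw [Matrix.det_transpose] at h
  rw [← h]
  ext j
  simp only [Matrix.mulVec, dotProduct, Matrix.transpose_apply, Finset.sum_apply, Pi.smul_apply,
    smul_eq_mul, Matrix.cramer_transpose_apply]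
  exact Finset.sum_congr rfl fun i _ => mul_comm _ _

theorem det_updateRow_eq_zero_of_ne {N : ℕ} (M : Matrix (Fin N) (Fin N) R) {i j : Fin N}
    (h : i ≠ j) : (M.updateRow i (M j)).det = 0 := by
  refine Matrix.det_zero_of_row_eq h ?_
  simp [Matrix.updateRow_ne h.symm]

theorem matrixOf_row {R : Type*} {N : ℕ} (v : Fin N → Fin N → R) (i : Fin N) : Matrix.of v i = v i := rfl

theorem bracket_updateRow_zero {n : ℕ} (c : Fin n → Fin (n + 2) → R) (u v w : Fin (n + 2) → R) :
    bracket c w v = ((Matrix.of (Fin.cons u (Fin.snoc c v : Fin (n + 1) → Fin (n + 2) → R) :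
    Fin (n + 2) → Fin (n + 2) → R)).updateRow 0 w).det := by
  have h := Fin.update_cons_zero (α := fun _ => Fin (n + 2) → R) u
    (Fin.snoc c v : Fin (n + 1) → Fin (n + 2) → R) w
  unfold bracket rowDet
  rw [← h]
  rfl

theorem bracket_updateRow_last {n : ℕ} (c : Fin n → Fin (n + 2) → R) (u v w : Fin (n + 2) → R) :
    bracket c u w = ((Matrix.of (Fin.cons u (Fin.snoc c v : Fin (n + 1) → Fin (n + 2) → R) :
    Fin (n + 2) → Fin (n + 2) → R)).updateRow (Fin.last (n + 1)) w).det := by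
  have h : Function.update (Fin.snoc c v : Fin (n + 1) → Fin (n + 2) → R) (Fin.last n) w =
      Fin.snoc c w := Fin.update_snoc_last ..
  have h' := Fin.cons_update (α := fun _ => Fin (n + 2) → R) u
    (Fin.snoc c v : Fin (n + 1) → Fin (n + 2) → R) (Fin.last n) w
  unfold bracket rowDet
  rw [← h, h', Fin.succ_last]
  rfl

/-- Cramer's rule expands `bracket c q r • p` in the rows `q`, `c`, `r`. The linear functional
`bracket c · s` kills the rows in `c`, so only the terms of `q` and `r` survive. -/
theorem bracket_plucker {n : ℕ} (c : Fin n → Fin (n + 2) → R) (p q r s : Fin (n + 2) → R) :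
    bracket c q r * bracket c p s = bracket c p r * bracket c q s + bracket c q p * bracket c r s := by
  set M : Matrix (Fin (n + 2)) (Fin (n + 2)) R :=
    Matrix.of (Fin.cons q (Fin.snoc c r : Fin (n + 1) → Fin (n + 2) → R)) with hM
  set M' : Matrix (Fin (n + 2)) (Fin (n + 2)) R :=
    Matrix.of (Fin.cons q (Fin.snoc c s : Fin (n + 1) → Fin (n + 2) → R)) with hM'
  have hφ : ∀ x, bracket c x s = Matrix.cramer M'.transpose x 0 := fun x => by
    rw [Matrix.cramer_transpose_apply, bracket_updateRow_zero c q s x]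
  have h := congrArg (fun x => Matrix.cramer M'.transpose x 0) (det_smul_eq_sum_det_updateRow M p)
  simp only [map_smul, map_sum, Finset.sum_apply, Pi.smul_apply, smul_eq_mul] at h
  rw [Fin.sum_univ_succ, Fin.sum_univ_castSucc] at h
  have hz : ∀ i : Fin n, Matrix.cramer M'.transpose (M i.castSucc.succ) 0 = 0 := by
    intro i
    rw [Matrix.cramer_transpose_apply]
    have : M i.castSucc.succ = M' i.castSucc.succ := by
      rw [hM, hM', matrixOf_row, matrixOf_row]
      simp
    rw [this]
    exact det_updateRow_eq_zero_of_ne _ (Fin.succ_ne_zero _).symm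
  simp only [hz, mul_zero, Finset.sum_const_zero, zero_add] at h
  have h0 : M 0 = q := rfl
  have h1 : M (Fin.last n).succ = r := by
    rw [hM, matrixOf_row]
    simp only [Fin.cons_succ, Fin.snoc_last]
  rw [h0, h1, ← hφ, ← hφ, ← hφ, Fin.succ_last, ← bracket_updateRow_zero c q r p,
    ← bracket_updateRow_last c q r p] at h
  exact h

theorem rowDet_snoc {n : ℕ} (v : Fin n → Fin (n + 1) → R) (a : Fin (n + 1) → R) :
    rowDet (Fin.snoc v a : Fin (n + 1) → Fin (n + 1) → R) =
      (-1) ^ n * rowDet (Fin.cons a v : Fin (n + 1) → Fin (n + 1) → R) := by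
  unfold rowDet
  rw [Fin.snoc_eq_cons_rotate]
  have := Matrix.det_permute (finRotate (n + 1))
    (Matrix.of (Fin.cons a v : Fin (n + 1) → Fin (n + 1) → R))
  rw [sign_finRotate] at this
  simpa [Matrix.submatrix, Function.comp_def] using this

theorem bracket_swap {n : ℕ} (c : Fin n → Fin (n + 2) → R) (u v : Fin (n + 2) → R) :
    bracket c u v = -bracket c v u := by
  have h0 : ∀ x, bracket c x x = 0 := by
    intro x
    refine Matrix.det_zero_of_row_eq (i := 0) (j := Fin.last (n + 1)) (by simp [Fin.ext_iff]) ?_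
    rw [← Fin.succ_last, matrixOf_row, matrixOf_row]
    simp only [Fin.cons_succ, Fin.snoc_last, Fin.cons_zero]
  have h := bracket_plucker c v u v u
  rw [h0, h0] at h
  have l1 : ∀ x y z, bracket c (x + y) z = bracket c x z + bracket c y z := by
    intro x y z
    rw [bracket_updateRow_zero c 0 z x, bracket_updateRow_zero c 0 z y,
      bracket_updateRow_zero c 0 z (x + y), Matrix.det_updateRow_add]
  have l2 : ∀ x y z, bracket c z (x + y) = bracket c z x + bracket c z y := by
    intro x y z
    rw [bracket_updateRow_last c z 0 x, bracket_updateRow_last c z 0 y,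
      bracket_updateRow_last c z 0 (x + y), Matrix.det_updateRow_add]
  have := h0 (u + v)
  rw [l1, l2, l2, h0, h0] at this
  linear_combination this

theorem rowDet_cons_single_zero {n : ℕ} (v : Fin n → Fin (n + 1) → R) :
    rowDet (Fin.cons (Pi.single 0 1) v : Fin (n + 1) → Fin (n + 1) → R) =
      rowDet fun i j => v i j.succ := by
  unfold rowDet
  rw [Matrix.det_succ_row _ 0, Finset.sum_eq_single 0]
  · simp only [Fin.val_zero, add_zero, pow_zero, Matrix.of_apply, Fin.cons_zero, Pi.single_eq_same,
      mul_one, one_mul]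
    congr 1
  · intro j _ hj
    simp [hj]
  · simp

theorem rowDet_snoc_single_last {n : ℕ} (v : Fin n → Fin (n + 1) → R) :
    rowDet (Fin.snoc v (Pi.single (Fin.last n) 1) : Fin (n + 1) → Fin (n + 1) → R) =
      rowDet fun i j => v i j.castSucc := by
  unfold rowDet
  rw [Matrix.det_succ_row _ (Fin.last n), Finset.sum_eq_single (Fin.last n)]
  · simp only [Fin.val_last, Matrix.of_apply, Fin.snoc_last, Pi.single_eq_same,
      mul_one, one_mul, Even.neg_one_pow ⟨n, rfl⟩]
    congr 1
    ext i j
    simp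
  · intro j _ hj
    simp [hj]
  · simp

theorem bracket_eq_cons {n : ℕ} (c : Fin n → Fin (n + 2) → R) (u v : Fin (n + 2) → R) :
    bracket c u v = (-1) ^ n * rowDet (Fin.cons u (Fin.cons v c : Fin (n + 1) → Fin (n + 2) → R) :
      Fin (n + 2) → Fin (n + 2) → R) := by
  rw [bracket_swap, bracket, Fin.cons_snoc_eq_snoc_cons, rowDet_snoc]
  ring

theorem bracket_eq_snoc {n : ℕ} (c : Fin n → Fin (n + 2) → R) (u v : Fin (n + 2) → R) :
    bracket c u v = (-1) ^ n * rowDet (Fin.snoc (Fin.snoc c u : Fin (n + 1) → Fin (n + 2) → R) v :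
      Fin (n + 2) → Fin (n + 2) → R) := by
  rw [bracket_swap, bracket, rowDet_snoc, ← mul_assoc, pow_succ]
  have : ((-1 : R) ^ n * ((-1) ^ n * -1)) = -1 := by
    rw [← mul_assoc, ← pow_add, Even.neg_one_pow ⟨n, rfl⟩]; ring
  rw [this]; ring

/-- A unit vector as a row deletes a column from the others. For rows of consecutive values,
deleting column 0 raises all indices by one, and deleting the last column leaves them unchanged. The
primed versions keep the remaining rows in the other order, at the cost of a sign. -/
theorem bracket_single_zero {n : ℕ} (c : Fin n → Fin (n + 2) → R) (u : Fin (n + 2) → R) :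
    bracket c u (Pi.single 0 1) =
      (-1) ^ (n + 1) * rowDet fun i j => (Fin.cons u c : Fin (n + 1) → Fin (n + 2) → R) i j.succ := by
  rw [bracket, Fin.cons_snoc_eq_snoc_cons, rowDet_snoc, rowDet_cons_single_zero]

theorem bracket_single_zero' {n : ℕ} (c : Fin n → Fin (n + 2) → R) (u : Fin (n + 2) → R) :
    bracket c u (Pi.single 0 1) =
      -rowDet fun i j => (Fin.snoc c u : Fin (n + 1) → Fin (n + 2) → R) i j.succ := by
  rw [bracket_swap, bracket, rowDet_cons_single_zero]

theorem bracket_single_last {n : ℕ} (c : Fin n → Fin (n + 2) → R) (u : Fin (n + 2) → R) :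
    bracket c u (Pi.single (Fin.last (n + 1)) 1) =
      rowDet fun i j => (Fin.cons u c : Fin (n + 1) → Fin (n + 2) → R) i j.castSucc := by
  rw [bracket, Fin.cons_snoc_eq_snoc_cons, rowDet_snoc_single_last]

theorem bracket_single_last' {n : ℕ} (c : Fin n → Fin (n + 2) → R) (u : Fin (n + 2) → R) :
    bracket c u (Pi.single (Fin.last (n + 1)) 1) =
      (-1) ^ n * rowDet fun i j => (Fin.snoc c u : Fin (n + 1) → Fin (n + 2) → R) i j.castSucc := by
  rw [bracket_eq_snoc, rowDet_snoc_single_last]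

theorem bracket_single_zero_last {n : ℕ} (c : Fin n → Fin (n + 2) → R) :
    bracket c (Pi.single 0 1) (Pi.single (Fin.last (n + 1)) 1) =
      rowDet fun i j => c i j.castSucc.succ := by
  rw [bracket, rowDet_cons_single_zero, ← rowDet_snoc_single_last (fun i j => c i j.succ)]
  congr 1
  ext i j
  refine Fin.lastCases ?_ (fun i => ?_) i
  · simp only [Fin.snoc_last, ← Fin.succ_last, Pi.single_apply, Fin.succ_inj]
  · simp

end Brackets

/-! ### Bilinear identities for Toeplitz determinants with an outer row moved. -/

section ToeplitzDeterminants

variable {R : Type*} [CommRing R] (h : ℤ → R)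

/-- The row `(h k, h (k + 1), …)` of length `N`. -/
def shiftRow (k : ℤ) (N : ℕ) : Fin N → R := fun j => h (k + (j : ℕ))

/-- The `n` rows of length `N` which start at `k`, `k - 1`, …. -/
def rowBlock (k : ℤ) (n N : ℕ) : Fin n → Fin N → R := fun i => shiftRow h (k - (i : ℕ)) N

/-- The Toeplitz determinant `det (h (m - i + j))` of size `n`. -/
def toepDet (m : ℤ) (n : ℕ) : R := rowDet (rowBlock h m n n)

/-- The Toeplitz determinant of size `n + 1` with its first row raised. -/
def raisedDet (m : ℤ) (n : ℕ) : R :=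
  rowDet (Fin.cons (shiftRow h (m + 1) (n + 1)) (rowBlock h (m - 1) n (n + 1)) :
    Fin (n + 1) → Fin (n + 1) → R)

/-- The Toeplitz determinant of size `n + 1` with its last row lowered. -/
def loweredDet (m : ℤ) (n : ℕ) : R :=
  rowDet (Fin.snoc (rowBlock h m n (n + 1)) (shiftRow h (m - n - 1) (n + 1)) :
    Fin (n + 1) → Fin (n + 1) → R)

theorem cons_rowBlock {k l : ℤ} (n N : ℕ) (hl : l = k - 1) :
    (Fin.cons (shiftRow h k N) (rowBlock h l n N) : Fin (n + 1) → Fin N → R) =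
      rowBlock h k (n + 1) N := by
  ext i j
  refine Fin.cases ?_ (fun i => ?_) i
  · simp [rowBlock]
  · simp only [Fin.cons_succ, rowBlock, shiftRow, hl, Fin.val_succ]
    congr 1; push_cast; ring

theorem snoc_rowBlock {k l : ℤ} (n N : ℕ) (hl : l = k - n) :
    (Fin.snoc (rowBlock h k n N) (shiftRow h l N) : Fin (n + 1) → Fin N → R) =
      rowBlock h k (n + 1) N := by
  ext i j
  refine Fin.lastCases ?_ (fun i => ?_) i
  · simp [rowBlock, hl]
  · simp [rowBlock]

theorem shiftRow_succ (k : ℤ) (N : ℕ) (j : Fin N) :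
    shiftRow h k (N + 1) j.succ = shiftRow h (k + 1) N j := by
  simp only [shiftRow, Fin.val_succ]
  congr 1; push_cast; ring

theorem shiftRow_castSucc (k : ℤ) (N : ℕ) (j : Fin N) :
    shiftRow h k (N + 1) j.castSucc = shiftRow h k N j := rfl

theorem rowBlock_succ (k : ℤ) (n N : ℕ) (i : Fin n) (j : Fin N) :
    rowBlock h k n (N + 1) i j.succ = rowBlock h (k + 1) n N i j := by
  rw [rowBlock, shiftRow_succ, rowBlock]
  congr 1; ring

theorem rowBlock_castSucc (k : ℤ) (n N : ℕ) (i : Fin n) (j : Fin N) :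
    rowBlock h k n (N + 1) i j.castSucc = rowBlock h k n N i j := rfl

theorem cons_rowBlock_succ (k l : ℤ) (n N : ℕ) (i : Fin (n + 1)) (j : Fin N) :
    (Fin.cons (shiftRow h k (N + 1)) (rowBlock h l n (N + 1)) : Fin (n + 1) → Fin (N + 1) → R)
      i j.succ =
    (Fin.cons (shiftRow h (k + 1) N) (rowBlock h (l + 1) n N) : Fin (n + 1) → Fin N → R) i j := by
  refine Fin.cases ?_ (fun i => ?_) i
  · simp [shiftRow_succ]
  · simp [rowBlock_succ]

theorem cons_rowBlock_castSucc (k l : ℤ) (n N : ℕ) (i : Fin (n + 1)) (j : Fin N) :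
    (Fin.cons (shiftRow h k (N + 1)) (rowBlock h l n (N + 1)) : Fin (n + 1) → Fin (N + 1) → R)
      i j.castSucc =
    (Fin.cons (shiftRow h k N) (rowBlock h l n N) : Fin (n + 1) → Fin N → R) i j := by
  refine Fin.cases ?_ (fun i => ?_) i
  · simp [shiftRow_castSucc]
  · simp [rowBlock_castSucc]

theorem snoc_rowBlock_succ (k l : ℤ) (n N : ℕ) (i : Fin (n + 1)) (j : Fin N) :
    (Fin.snoc (rowBlock h l n (N + 1)) (shiftRow h k (N + 1)) : Fin (n + 1) → Fin (N + 1) → R)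
      i j.succ =
    (Fin.snoc (rowBlock h (l + 1) n N) (shiftRow h (k + 1) N) : Fin (n + 1) → Fin N → R) i j := by
  refine Fin.lastCases ?_ (fun i => ?_) i
  · simp [shiftRow_succ]
  · simp [rowBlock_succ]

theorem snoc_rowBlock_castSucc (k l : ℤ) (n N : ℕ) (i : Fin (n + 1)) (j : Fin N) :
    (Fin.snoc (rowBlock h l n (N + 1)) (shiftRow h k (N + 1)) : Fin (n + 1) → Fin (N + 1) → R)
      i j.castSucc =
    (Fin.snoc (rowBlock h l n N) (shiftRow h k N) : Fin (n + 1) → Fin N → R) i j := by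
  refine Fin.lastCases ?_ (fun i => ?_) i
  · simp [shiftRow_castSucc]
  · simp [rowBlock_castSucc]

@[simp] theorem toepDet_zero_right (m : ℤ) : toepDet h m 0 = 1 := by
  simp [toepDet, rowDet]

@[simp] theorem toepDet_one_right (m : ℤ) : toepDet h m 1 = h m := by
  simp [toepDet, rowDet, rowBlock, shiftRow]

theorem toepDet_zero_left (h0 : h 0 = 1) (hneg : ∀ k < 0, h k = 0) (n : ℕ) :
    toepDet h 0 n = 1 := by
  unfold toepDet rowDet
  rw [Matrix.det_of_isUpperTriangular]
  · simp [rowBlock, shiftRow, h0]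
  · intro i j hij
    simp only [id] at hij
    simp only [Matrix.of_apply, rowBlock, shiftRow]
    exact hneg _ (by have : (j : ℕ) < i := hij; omega)

theorem toepDet_neg_one_left (hneg : ∀ k < 0, h k = 0) (n : ℕ) :
    toepDet h (-1) (n + 1) = 0 := by
  unfold toepDet rowDet
  rw [Matrix.det_of_isUpperTriangular]
  · rw [Fin.prod_univ_succ]
    simp [rowBlock, shiftRow, hneg]
  · intro i j hij
    simp only [id] at hij
    simp only [Matrix.of_apply, rowBlock, shiftRow]
    exact hneg _ (by have : (j : ℕ) < i := hij; omega)

/-- Plücker relation whose common rows start at m - 1, …, m - n, with four further vectors: the rows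
starting at m + 1, m, m - n - 1, and the first unit vector. -/
theorem raisedDet_mul_sub (m : ℤ) (n : ℕ) :
    raisedDet h m (n + 1) * toepDet h (m + 1) (n + 1) -
      toepDet h m (n + 2) * raisedDet h (m + 1) n =
    toepDet h (m + 1) (n + 2) * toepDet h m (n + 1) := by
  set c := rowBlock h (m - 1) n (n + 2) with hc
  have key := bracket_plucker c (shiftRow h (m + 1) (n + 2)) (shiftRow h m (n + 2))
    (shiftRow h (m - 1 - n) (n + 2)) (Pi.single 0 1)
  have e1 : bracket c (shiftRow h m (n + 2)) (shiftRow h (m - 1 - n) (n + 2)) =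
      toepDet h m (n + 2) := by
    rw [bracket, hc, snoc_rowBlock h n _ rfl, cons_rowBlock h _ _ rfl, toepDet]
  have e2 : bracket c (shiftRow h (m + 1) (n + 2)) (Pi.single 0 1) =
      (-1) ^ (n + 1) * raisedDet h (m + 1) n := by
    rw [bracket_single_zero]
    simp only [hc, cons_rowBlock_succ]
    rw [raisedDet, sub_add_cancel, add_sub_cancel_right]
  have e3 : bracket c (shiftRow h (m + 1) (n + 2)) (shiftRow h (m - 1 - n) (n + 2)) =
      raisedDet h m (n + 1) := by
    rw [bracket, hc, snoc_rowBlock h n _ rfl, raisedDet]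
  have e4 : bracket c (shiftRow h m (n + 2)) (Pi.single 0 1) =
      (-1) ^ (n + 1) * toepDet h (m + 1) (n + 1) := by
    rw [bracket_single_zero]
    simp only [hc, cons_rowBlock_succ]
    rw [cons_rowBlock h _ _ (by ring), toepDet]
  have e5 : bracket c (shiftRow h m (n + 2)) (shiftRow h (m + 1) (n + 2)) =
      (-1) ^ (n + 1) * toepDet h (m + 1) (n + 2) := by
    rw [bracket_swap, bracket_eq_cons, hc, cons_rowBlock h _ _ rfl, cons_rowBlock h _ _ (by ring),
      toepDet]
    ring
  have e6 : bracket c (shiftRow h (m - 1 - n) (n + 2)) (Pi.single 0 1) =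
      -toepDet h m (n + 1) := by
    rw [bracket_single_zero']
    simp only [hc, snoc_rowBlock_succ]
    rw [snoc_rowBlock h n _ (by ring), toepDet, sub_add_cancel]
  rw [e1, e2, e3, e4, e5, e6] at key
  have hs : ((-1 : R) ^ (n + 1)) * (-1) ^ (n + 1) = 1 := by
    rw [← pow_add, Even.neg_one_pow ⟨n + 1, rfl⟩]
  linear_combination (-1) ^ (n + 1) * (-key) + (raisedDet h m (n + 1) * toepDet h (m + 1) (n + 1) -
      toepDet h m (n + 2) * raisedDet h (m + 1) n -
    toepDet h (m + 1) (n + 2) * toepDet h m (n + 1)) * (-hs)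

/-- Same common rows as for `raisedDet_mul_sub`, with the row starting at m - n - 2 in place of m +
1. -/
theorem loweredDet_mul_sub (m : ℤ) (n : ℕ) :
    loweredDet h m n * toepDet h m (n + 2) - toepDet h m (n + 1) * loweredDet h m (n + 1) =
      -(toepDet h (m + 1) (n + 1) * toepDet h (m - 1) (n + 2)) := by
  set c := rowBlock h (m - 1) n (n + 2) with hc
  have key := bracket_plucker c (shiftRow h (m - 1 - n - 1) (n + 2))
    (shiftRow h m (n + 2)) (shiftRow h (m - 1 - n) (n + 2)) (Pi.single 0 1)
  have e1 : bracket c (shiftRow h m (n + 2)) (shiftRow h (m - 1 - n) (n + 2)) =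
      toepDet h m (n + 2) := by
    rw [bracket, hc, snoc_rowBlock h n _ rfl, cons_rowBlock h _ _ rfl, toepDet]
  have e2 : bracket c (shiftRow h (m - 1 - n - 1) (n + 2)) (Pi.single 0 1) =
      -loweredDet h m n := by
    rw [bracket_single_zero']
    simp only [hc, snoc_rowBlock_succ]
    rw [loweredDet, sub_add_cancel, sub_add_cancel, show m - 1 - (n : ℤ) = m - n - 1 by ring]
  have e3 : bracket c (shiftRow h (m - 1 - n - 1) (n + 2)) (shiftRow h (m - 1 - n) (n + 2)) =
      -((-1) ^ n * toepDet h (m - 1) (n + 2)) := by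
    rw [bracket_swap, bracket_eq_snoc, hc, snoc_rowBlock h n _ rfl,
      snoc_rowBlock h _ _ (by push_cast; ring), toepDet]
  have e4 : bracket c (shiftRow h m (n + 2)) (Pi.single 0 1) =
      (-1) ^ (n + 1) * toepDet h (m + 1) (n + 1) := by
    rw [bracket_single_zero]
    simp only [hc, cons_rowBlock_succ]
    rw [cons_rowBlock h _ _ (by ring), toepDet]
  have e5 : bracket c (shiftRow h m (n + 2)) (shiftRow h (m - 1 - n - 1) (n + 2)) =
      loweredDet h m (n + 1) := by
    rw [bracket, hc, Fin.cons_snoc_eq_snoc_cons, cons_rowBlock h _ _ rfl, loweredDet]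
    congr 3; push_cast; ring
  have e6 : bracket c (shiftRow h (m - 1 - n) (n + 2)) (Pi.single 0 1) =
      -toepDet h m (n + 1) := by
    rw [bracket_single_zero']
    simp only [hc, snoc_rowBlock_succ]
    rw [snoc_rowBlock h n _ (by ring), toepDet, sub_add_cancel]
  rw [e1, e2, e3, e4, e5, e6] at key
  have hs : ((-1 : R) ^ (n + 1)) * (-1) ^ n = -1 := by
    rw [pow_succ, mul_right_comm, ← pow_add, Even.neg_one_pow ⟨n, rfl⟩, one_mul]
  linear_combination -key - toepDet h (m - 1) (n + 2) * toepDet h (m + 1) (n + 1) * (-hs)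

/-- The common rows start at m, …, m - n + 1. The further vectors are the next two rows and both
outer unit vectors, which together delete the first and last columns. -/
theorem loweredDet_succ_mul_sub (m : ℤ) (n : ℕ) :
    loweredDet h (m + 1) n * toepDet h m (n + 1) - toepDet h (m + 1) (n + 1) * loweredDet h m n =
      toepDet h (m + 1) n * toepDet h m (n + 2) := by
  set c := rowBlock h m n (n + 2) with hc
  have key := bracket_plucker c (shiftRow h (m - n - 1) (n + 2))
    (shiftRow h (m - n) (n + 2)) (Pi.single 0 1) (Pi.single (Fin.last (n + 1)) 1)
  have e1 : bracket c (shiftRow h (m - n) (n + 2)) (Pi.single 0 1) =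
      -toepDet h (m + 1) (n + 1) := by
    rw [bracket_single_zero']
    simp only [hc, snoc_rowBlock_succ]
    rw [snoc_rowBlock h n _ (by ring), toepDet]
  have e2 : bracket c (shiftRow h (m - n - 1) (n + 2)) (Pi.single (Fin.last (n + 1)) 1) =
      (-1) ^ n * loweredDet h m n := by
    rw [bracket_single_last']
    simp only [hc, snoc_rowBlock_castSucc]
    rw [loweredDet]
  have e3 : bracket c (shiftRow h (m - n - 1) (n + 2)) (Pi.single 0 1) =
      -loweredDet h (m + 1) n := by
    rw [bracket_single_zero']
    simp only [hc, snoc_rowBlock_succ]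
    rw [loweredDet, show m + 1 - (n : ℤ) - 1 = m - n - 1 + 1 by ring]
  have e4 : bracket c (shiftRow h (m - n) (n + 2)) (Pi.single (Fin.last (n + 1)) 1) =
      (-1) ^ n * toepDet h m (n + 1) := by
    rw [bracket_single_last']
    simp only [hc, snoc_rowBlock_castSucc]
    rw [snoc_rowBlock h n _ rfl, toepDet]
  have e5 : bracket c (shiftRow h (m - n) (n + 2)) (shiftRow h (m - n - 1) (n + 2)) =
      (-1) ^ n * toepDet h m (n + 2) := by
    rw [bracket_eq_snoc, hc, snoc_rowBlock h n _ rfl, snoc_rowBlock h _ _ (by push_cast; ring),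
      toepDet]
  have e6 : bracket c (Pi.single 0 1) (Pi.single (Fin.last (n + 1)) 1) = toepDet h (m + 1) n := by
    rw [bracket_single_zero_last]
    simp only [hc, rowBlock_succ]
    rfl
  rw [e1, e2, e3, e4, e5, e6] at key
  have hs : ((-1 : R) ^ n) * (-1) ^ n = 1 := by
    rw [← pow_add, Even.neg_one_pow ⟨n, rfl⟩]
  linear_combination (-1) ^ n * key + (toepDet h (m + 1) n * toepDet h m (n + 2)
    - loweredDet h (m + 1) n * toepDet h m (n + 1)
    + toepDet h (m + 1) (n + 1) * loweredDet h m n) * hs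

/-- The common rows start at m, …, m - n + 1. The further vectors are the rows starting at m + 1, m
- n, m - n - 1 and the last unit vector. -/
theorem loweredDet_succ_succ_mul_sub (m : ℤ) (n : ℕ) :
    loweredDet h (m + 1) (n + 1) * toepDet h m (n + 1) -
      toepDet h (m + 1) (n + 2) * loweredDet h m n =
    toepDet h (m + 1) (n + 1) * toepDet h m (n + 2) := by
  set c := rowBlock h m n (n + 2) with hc
  have key := bracket_plucker c (shiftRow h (m - n - 1) (n + 2)) (shiftRow h (m + 1) (n + 2))
    (shiftRow h (m - n) (n + 2)) (Pi.single (Fin.last (n + 1)) 1)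
  have e1 : bracket c (shiftRow h (m + 1) (n + 2)) (shiftRow h (m - n) (n + 2)) =
      toepDet h (m + 1) (n + 2) := by
    rw [bracket, hc, snoc_rowBlock h n _ rfl, cons_rowBlock h _ _ (by ring), toepDet]
  have e2 : bracket c (shiftRow h (m - n - 1) (n + 2)) (Pi.single (Fin.last (n + 1)) 1) =
      (-1) ^ n * loweredDet h m n := by
    rw [bracket_single_last']
    simp only [hc, snoc_rowBlock_castSucc]
    rw [loweredDet]
  have e3 : bracket c (shiftRow h (m - n - 1) (n + 2)) (shiftRow h (m - n) (n + 2)) =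
      -((-1) ^ n * toepDet h m (n + 2)) := by
    rw [bracket_swap, bracket_eq_snoc, hc, snoc_rowBlock h n _ rfl,
      snoc_rowBlock h _ _ (by push_cast; ring), toepDet]
  have e4 : bracket c (shiftRow h (m + 1) (n + 2)) (Pi.single (Fin.last (n + 1)) 1) =
      toepDet h (m + 1) (n + 1) := by
    rw [bracket_single_last]
    simp only [hc, cons_rowBlock_castSucc]
    rw [cons_rowBlock h _ _ (by ring), toepDet]
  have e5 : bracket c (shiftRow h (m + 1) (n + 2)) (shiftRow h (m - n - 1) (n + 2)) =
      loweredDet h (m + 1) (n + 1) := by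
    rw [bracket, hc, Fin.cons_snoc_eq_snoc_cons, cons_rowBlock h _ _ (by ring), loweredDet]
    congr 3; push_cast; ring
  have e6 : bracket c (shiftRow h (m - n) (n + 2)) (Pi.single (Fin.last (n + 1)) 1) =
      (-1) ^ n * toepDet h m (n + 1) := by
    rw [bracket_single_last']
    simp only [hc, snoc_rowBlock_castSucc]
    rw [snoc_rowBlock h n _ rfl, toepDet]
  rw [e1, e2, e3, e4, e5, e6] at key
  have hs : ((-1 : R) ^ n) * (-1) ^ n = 1 := by
    rw [← pow_add, Even.neg_one_pow ⟨n, rfl⟩]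
  linear_combination (-1) ^ n * (-key) + (toepDet h (m + 1) (n + 1) * toepDet h m (n + 2)
    - loweredDet h (m + 1) (n + 1) * toepDet h m (n + 1)
    + toepDet h (m + 1) (n + 2) * loweredDet h m n) * hs

end ToeplitzDeterminants

/-! ### Toeplitz determinants of Hermite polynomials and their Wronskian relations. -/

section HermiteDeterminants

/-- The Hermite polynomials divided by factorials, the coefficients of `exp (2 y s - s ^ 2)`. -/
def hermiteCoeff : ℕ → ℂ[X]
  | 0 => 1
  | 1 => 2 * X
  | k + 2 => C (((k : ℂ) + 2)⁻¹) * (2 * X * hermiteCoeff (k + 1) - 2 * hermiteCoeff k)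

/-- `hermiteCoeff`, extended by zero to negative indices. -/
def hermiteCoeffInt : ℤ → ℂ[X]
  | Int.ofNat k => hermiteCoeff k
  | Int.negSucc _ => 0

theorem hermiteCoeffInt_of_neg {k : ℤ} (hk : k < 0) : hermiteCoeffInt k = 0 := by
  obtain ⟨j, rfl⟩ := Int.eq_negSucc_of_lt_zero hk
  rfl

@[simp] theorem hermiteCoeffInt_zero : hermiteCoeffInt 0 = 1 := by
  change hermiteCoeff 0 = 1
  rw [hermiteCoeff]

theorem hermiteCoeff_recurrence (k : ℕ) :
    ((k : ℂ[X]) + 2) * hermiteCoeff (k + 2) =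
      2 * X * hermiteCoeff (k + 1) - 2 * hermiteCoeff k := by
  rw [hermiteCoeff]
  have hk : ((k : ℂ) + 2) ≠ 0 := by exact_mod_cast (by omega : k + 2 ≠ 0)
  have : ((k : ℂ[X]) + 2) * C (((k : ℂ) + 2)⁻¹) = 1 := by
    rw [show ((k : ℂ[X]) + 2) = C ((k : ℂ) + 2) by simp [map_ofNat C], ← C_mul, mul_inv_cancel₀ hk, C_1]
  rw [← mul_assoc, this, one_mul]

theorem hermiteCoeffInt_recurrence (k : ℤ) :
    (k : ℂ[X]) * hermiteCoeffInt k =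
      2 * X * hermiteCoeffInt (k - 1) - 2 * hermiteCoeffInt (k - 2) := by
  match k with
  | Int.negSucc j =>
    rw [hermiteCoeffInt_of_neg (Int.negSucc_lt_zero j), hermiteCoeffInt_of_neg,
      hermiteCoeffInt_of_neg]
    · simp
    all_goals have := Int.negSucc_lt_zero j; omega
  | Int.ofNat 0 =>
    rw [hermiteCoeffInt_of_neg (k := _ - 1) (by simp), hermiteCoeffInt_of_neg (k := _ - 2) (by simp)]
    simp
  | Int.ofNat 1 =>
    rw [hermiteCoeffInt_of_neg (k := _ - 2) (by simp)]
    change ((1 : ℤ) : ℂ[X]) * hermiteCoeff 1 = 2 * X * hermiteCoeff 0 - 2 * 0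
    simp [hermiteCoeff]
  | Int.ofNat (k + 2) =>
    have := hermiteCoeff_recurrence k
    have e1 : Int.ofNat (k + 2) - 1 = Int.ofNat (k + 1) := by simp; ring
    have e2 : Int.ofNat (k + 2) - 2 = Int.ofNat k := by simp
    rw [e1, e2]
    change (((k + 2 : ℕ) : ℤ) : ℂ[X]) * hermiteCoeff (k + 2) =
      2 * X * hermiteCoeff (k + 1) - 2 * hermiteCoeff k
    rw [← this]
    push_cast; ring

theorem derivative_hermiteCoeff_succ (k : ℕ) :
    derivative (hermiteCoeff (k + 1)) = 2 * hermiteCoeff k := by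
  induction k using Nat.twoStepInduction with
  | zero => simp [hermiteCoeff]
  | one =>
    have h := congrArg derivative (hermiteCoeff_recurrence 0)
    simp only [derivative_mul, derivative_sub, derivative_add, derivative_natCast,
      derivative_ofNat, derivative_X, hermiteCoeff, derivative_one] at h ⊢
    simp only [zero_add, derivative_C, zero_mul] at h ⊢
    have h2 : (2 : ℂ[X]) ≠ 0 := two_ne_zero
    apply mul_left_cancel₀ h2
    push_cast at h ⊢
    linear_combination h
  | more k ih0 ih1 =>
    have h := congrArg derivative (hermiteCoeff_recurrence (k + 1))
    have h' := hermiteCoeff_recurrence k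
    simp only [derivative_mul, derivative_sub, derivative_add, derivative_natCast,
      derivative_ofNat, derivative_X] at h
    rw [show k + 1 + 1 = k + 2 from rfl, ih1, ih0] at h
    have hk : ((k : ℂ[X]) + 3) ≠ 0 := by exact_mod_cast (by omega : k + 3 ≠ 0)
    apply mul_left_cancel₀ hk
    push_cast at h
    linear_combination h - 2 * h'

theorem derivative_hermiteCoeffInt (k : ℤ) :
    derivative (hermiteCoeffInt k) = 2 * hermiteCoeffInt (k - 1) := by
  match k with
  | Int.negSucc j =>
    rw [hermiteCoeffInt_of_neg (Int.negSucc_lt_zero j), hermiteCoeffInt_of_neg]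
    · simp
    · have := Int.negSucc_lt_zero j
      omega
  | Int.ofNat 0 =>
    rw [hermiteCoeffInt_of_neg (k := _ - 1) (by simp)]
    simp
  | Int.ofNat (k + 1) =>
    have e1 : Int.ofNat (k + 1) - 1 = Int.ofNat k := by simp
    rw [e1]
    exact derivative_hermiteCoeff_succ k

/-- Both sides are the trace of `Y * A.adjugate`. -/
theorem sum_det_updateRow_eq_sum_det_updateCol {R : Type*} [CommRing R] {N : ℕ}
    (A Y : Matrix (Fin N) (Fin N) R) :
    ∑ i, (A.updateRow i (Y i)).det = ∑ j, (A.updateCol j fun i => Y i j).det := by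
  have h1 : ∀ i, (A.updateRow i (Y i)).det = (Y * A.adjugate) i i := by
    intro i
    rw [← Matrix.cramer_transpose_apply, Matrix.mul_apply, Matrix.cramer_eq_adjugate_mulVec,
      ← Matrix.adjugate_transpose]
    simp [Matrix.mulVec, dotProduct, mul_comm]
  have h2 : ∀ j, (A.updateCol j fun i => Y i j).det = (A.adjugate * Y) j j := by
    intro j
    rw [← Matrix.cramer_apply, Matrix.mul_apply, Matrix.cramer_eq_adjugate_mulVec]
    simp [Matrix.mulVec, dotProduct]
  simp only [h1, h2]
  exact Matrix.trace_mul_comm Y A.adjugate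

theorem derivative_det {N : ℕ} (M : Matrix (Fin N) (Fin N) ℂ[X]) :
    derivative M.det = ∑ i, (M.updateRow i fun j => derivative (M i j)).det := by
  refine Eq.trans ?_
    (sum_det_updateRow_eq_sum_det_updateCol M (Matrix.of fun i j => derivative (M i j))).symm
  simp only [Matrix.det_apply', derivative_sum, derivative_mul, derivative_intCast, zero_mul,
    zero_add, derivative_prod_finset, Finset.mul_sum]
  rw [Finset.sum_comm]
  refine Finset.sum_congr rfl fun j _ => Finset.sum_congr rfl fun σ _ => ?_
  rw [← Finset.prod_erase_mul _ _ (Finset.mem_univ j)]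
  simp only [Matrix.updateCol_self, Matrix.of_apply]
  congr 2
  refine Finset.prod_congr rfl fun i hi => ?_
  rw [Matrix.updateCol_ne (Finset.ne_of_mem_erase hi)]

/-- The three-term recurrence reads (κ_i + 1 + j) Z_ij = 2y A_ij - A_ij', where Z has the raised
rows. The factor κ_i + 1 is constant along a row. The factor j is handled by passing from row to
column replacements, where it becomes the constant n. -/
theorem sum_det_raise_row {n : ℕ} (κ : Fin (n + 1) → ℤ) (A : Matrix (Fin (n + 1)) (Fin (n + 1)) ℂ[X])
    (hA : A = Matrix.of fun i => shiftRow hermiteCoeffInt (κ i) (n + 1)) :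
    ∑ i, ((κ i + n + 1 : ℤ) : ℂ[X]) *
        (A.updateRow i (shiftRow hermiteCoeffInt (κ i + 1) (n + 1))).det =
      2 * ((n : ℂ[X]) + 1) * X * A.det - derivative A.det := by
  set Z : Matrix (Fin (n + 1)) (Fin (n + 1)) ℂ[X] :=
    Matrix.of fun i => shiftRow hermiteCoeffInt (κ i + 1) (n + 1) with hZ
  set W : Matrix (Fin (n + 1)) (Fin (n + 1)) ℂ[X] :=
    Matrix.of fun i j => ((j : ℕ) : ℂ[X]) * Z i j with hW
  have hrow : ∀ i : Fin (n + 1), ((κ i + 1 : ℤ) : ℂ[X]) • Z i + W i =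
      (2 * X : ℂ[X]) • A i + (-1 : ℂ[X]) • (fun j => derivative (A i j) : Fin (n + 1) → ℂ[X]) := by
    intro i
    funext j
    have h1 := hermiteCoeffInt_recurrence (κ i + 1 + (j : ℕ))
    have h2 := derivative_hermiteCoeffInt (κ i + (j : ℕ))
    rw [show κ i + 1 + (j : ℕ) - 1 = κ i + (j : ℕ) by ring,
      show κ i + 1 + (j : ℕ) - 2 = κ i + (j : ℕ) - 1 by ring] at h1
    have e1 : Z i j = hermiteCoeffInt (κ i + 1 + (j : ℕ)) := rfl
    have e2 : A i j = hermiteCoeffInt (κ i + (j : ℕ)) := by rw [hA]; rfl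
    have e3 : W i j = (j : ℕ) * Z i j := rfl
    simp only [Pi.add_apply, Pi.smul_apply, smul_eq_mul, e3, e1, e2, h2]
    push_cast at h1 ⊢
    linear_combination h1
  -- Column j of Z is column j + 1 of A, so replacing any column but the last gives a repeated
  -- column; only j = n contributes.
  have hcol : ∀ j, (A.updateCol j fun i => W i j).det =
      (n : ℂ[X]) * (A.updateCol j fun i => Z i j).det := by
    intro j
    have hs : (A.updateCol j fun i => W i j).det =
        ((j : ℕ) : ℂ[X]) * (A.updateCol j fun i => Z i j).det :=
      Matrix.det_updateCol_smul A j ((j : ℕ) : ℂ[X]) fun i => Z i j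
    rw [hs]
    refine Fin.lastCases ?_ (fun j => ?_) j
    · simp
    · have hz : (A.updateCol j.castSucc fun i => Z i j.castSucc).det = 0 := by
        refine Matrix.det_zero_of_column_eq (i := j.castSucc) (j := j.succ)
          (by simp [Fin.ext_iff]) fun i => ?_
        rw [Matrix.updateCol_self, Matrix.updateCol_ne (by simp [Fin.ext_iff])]
        rw [hZ, hA]
        simp only [Matrix.of_apply, shiftRow, Fin.val_castSucc, Fin.val_succ]
        congr 1; push_cast; ring
      rw [hz, mul_zero, mul_zero]
  have hsum := sum_det_updateRow_eq_sum_det_updateCol A W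
  rw [Finset.sum_congr rfl fun j _ => hcol j, ← Finset.mul_sum,
    ← sum_det_updateRow_eq_sum_det_updateCol A Z] at hsum
  have hL : ∀ i, ((κ i + 1 : ℤ) : ℂ[X]) * (A.updateRow i (Z i)).det + (A.updateRow i (W i)).det =
      2 * X * A.det + (-1) * (A.updateRow i fun j => derivative (A i j)).det := by
    intro i
    have := congrArg (fun r => (A.updateRow i r).det) (hrow i)
    simp only [Matrix.det_updateRow_add, Matrix.det_updateRow_smul] at this
    rwa [Matrix.updateRow_eq_self] at this
  have hL' := Finset.sum_congr (s₁ := Finset.univ) rfl fun i _ => hL i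
  rw [Finset.sum_add_distrib, Finset.sum_add_distrib, hsum, ← Finset.mul_sum, ← Finset.mul_sum _ _ (-1 : ℂ[X]), ← derivative_det,
    Finset.mul_sum _ _ (n : ℂ[X]), ← Finset.sum_add_distrib] at hL'
  simp only [Finset.sum_const, Finset.card_univ, Fintype.card_fin, nsmul_eq_mul] at hL'
  push_cast at hL'
  calc _ = ∑ i, (((κ i : ℂ[X]) + 1) * (A.updateRow i (Z i)).det +
        (n : ℂ[X]) * (A.updateRow i (Z i)).det) := by
        refine Finset.sum_congr rfl fun i _ => ?_
        have : Z i = shiftRow hermiteCoeffInt (κ i + 1) (n + 1) := rfl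
        rw [this]; push_cast; ring
    _ = _ := by rw [hL']; ring

/-- The Toeplitz determinant `det (h (m - i + j))` of size `n` in `h k = H k / k!`. -/
def hermiteDet (m : ℤ) (n : ℕ) : ℂ[X] := toepDet hermiteCoeffInt m n

theorem rowBlock_updateRow_zero {R : Type*} [CommRing R] (h : ℤ → R) (m : ℤ) (n : ℕ) :
    ((Matrix.of (rowBlock h m (n + 1) (n + 1))).updateRow 0 (shiftRow h (m + 1) (n + 1))).det =
      raisedDet h m n := by
  have h1 := Fin.update_cons_zero (α := fun _ => Fin (n + 1) → R) (shiftRow h m (n + 1))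
    (rowBlock h (m - 1) n (n + 1)) (shiftRow h (m + 1) (n + 1))
  rw [cons_rowBlock h _ _ rfl] at h1
  unfold raisedDet rowDet
  rw [← h1]
  rfl

theorem rowBlock_updateRow_last {R : Type*} [CommRing R] (h : ℤ → R) (m : ℤ) (n : ℕ) :
    ((Matrix.of (rowBlock h m (n + 1) (n + 1))).updateRow (Fin.last n)
      (shiftRow h (m - n - 1) (n + 1))).det = loweredDet h m n := by
  have h1 : Function.update (Fin.snoc (rowBlock h m n (n + 1)) (shiftRow h (m - n) (n + 1)) :
      Fin (n + 1) → Fin (n + 1) → R) (Fin.last n) (shiftRow h (m - n - 1) (n + 1)) =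
      Fin.snoc (rowBlock h m n (n + 1)) (shiftRow h (m - n - 1) (n + 1)) :=
    Fin.update_snoc_last ..
  rw [snoc_rowBlock h _ _ rfl] at h1
  unfold loweredDet rowDet
  rw [← h1]
  rfl

/-- When consecutive rows start at m, m - 1, …, raising any row but the first repeats the row above
it, so a single term of `sum_det_raise_row` is left. -/
theorem raisedDet_eq (m : ℤ) (n : ℕ) :
    ((m : ℂ[X]) + (n : ℂ[X]) + 1) * raisedDet hermiteCoeffInt m n =
      2 * ((n : ℂ[X]) + 1) * X * hermiteDet m (n + 1) - derivative (hermiteDet m (n + 1)) := by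
  have h := sum_det_raise_row (fun i : Fin (n + 1) => m - (i : ℕ))
    (Matrix.of (rowBlock hermiteCoeffInt m (n + 1) (n + 1))) rfl
  rw [Fin.sum_univ_succ, Finset.sum_eq_zero, add_zero] at h
  · simp only [Fin.val_zero, Nat.cast_zero, sub_zero, rowBlock_updateRow_zero] at h
    push_cast at h
    exact h
  · intro i _
    rw [mul_eq_zero]
    right
    have := det_updateRow_eq_zero_of_ne (Matrix.of (rowBlock hermiteCoeffInt m (n + 1) (n + 1)))
      (i := i.succ) (j := i.castSucc) (by simp [Fin.ext_iff])
    rw [matrixOf_row, rowBlock] at this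
    rw [← this]
    congr 3
    simp only [Fin.val_succ, Fin.val_castSucc]
    push_cast; ring

/-- Differentiating a row lowers it by one and doubles it; for every row but the last this repeats
the row below. -/
theorem derivative_hermiteDet_succ (m : ℤ) (n : ℕ) :
    derivative (hermiteDet m (n + 1)) = 2 * loweredDet hermiteCoeffInt m n := by
  unfold hermiteDet toepDet rowDet
  rw [derivative_det]
  have hrow : ∀ i : Fin (n + 1), (fun j => derivative
      ((Matrix.of (rowBlock hermiteCoeffInt m (n + 1) (n + 1))) i j)) =
      (2 : ℂ[X]) • shiftRow hermiteCoeffInt (m - (i : ℕ) - 1) (n + 1) := by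
    intro i
    funext j
    simp only [Matrix.of_apply, rowBlock, shiftRow, Pi.smul_apply, smul_eq_mul,
      derivative_hermiteCoeffInt]
    congr 2; ring
  simp only [hrow, Matrix.det_updateRow_smul]
  rw [Fin.sum_univ_castSucc, Finset.sum_eq_zero, zero_add, Fin.val_last, rowBlock_updateRow_last]
  intro i _
  rw [mul_eq_zero]
  right
  have := det_updateRow_eq_zero_of_ne (Matrix.of (rowBlock hermiteCoeffInt m (n + 1) (n + 1)))
    (i := i.castSucc) (j := i.succ) (by simp [Fin.ext_iff])
  rw [matrixOf_row, rowBlock] at this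
  rw [← this]
  congr 3
  simp only [Fin.val_succ, Fin.val_castSucc]
  push_cast; ring

@[simp] theorem hermiteDet_zero_right (m : ℤ) : hermiteDet m 0 = 1 := toepDet_zero_right _ _

@[simp] theorem hermiteDet_zero_left (n : ℕ) : hermiteDet 0 n = 1 :=
  toepDet_zero_left _ hermiteCoeffInt_zero (fun _ => hermiteCoeffInt_of_neg) n

theorem hermiteDet_neg_one_left (n : ℕ) : hermiteDet (-1) (n + 1) = 0 :=
  toepDet_neg_one_left _ (fun _ => hermiteCoeffInt_of_neg) n

theorem hermiteDet_one_right (m : ℤ) : hermiteDet m 1 = hermiteCoeffInt m := toepDet_one_right _ _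

/-- Logarithmically differentiated ratio of neighbours in the second index. -/
theorem wronskian_right (m : ℤ) (n : ℕ) :
    derivative (hermiteDet m n) * hermiteDet m (n + 1) -
      hermiteDet m n * derivative (hermiteDet m (n + 1)) =
    -2 * hermiteDet (m + 1) n * hermiteDet (m - 1) (n + 1) := by
  cases n with
  | zero => simp [hermiteDet_one_right, derivative_hermiteCoeffInt]
  | succ n =>
    rw [derivative_hermiteDet_succ, derivative_hermiteDet_succ]
    have := loweredDet_mul_sub hermiteCoeffInt m n
    unfold hermiteDet
    linear_combination 2 * this

/-- Logarithmically differentiated ratio of neighbours in the first index. -/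
theorem wronskian_left (m : ℤ) (n : ℕ) :
    derivative (hermiteDet (m + 1) (n + 1)) * hermiteDet m (n + 1) -
      hermiteDet (m + 1) (n + 1) * derivative (hermiteDet m (n + 1)) =
    2 * hermiteDet (m + 1) n * hermiteDet m (n + 2) := by
  rw [derivative_hermiteDet_succ, derivative_hermiteDet_succ]
  have := loweredDet_succ_mul_sub hermiteCoeffInt m n
  unfold hermiteDet
  linear_combination 2 * this

/-- Logarithmically differentiated ratio of neighbours along an antidiagonal. -/
theorem wronskian_antidiag (m : ℤ) (n : ℕ) :
    derivative (hermiteDet m (n + 1)) * hermiteDet (m + 1) n -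
      hermiteDet m (n + 1) * derivative (hermiteDet (m + 1) n) -
      2 * X * hermiteDet m (n + 1) * hermiteDet (m + 1) n =
    -((m : ℂ[X]) + (n : ℂ[X]) + 1) * hermiteDet (m + 1) (n + 1) * hermiteDet m n := by
  cases n with
  | zero =>
    have := hermiteCoeffInt_recurrence (m + 1)
    rw [show m + 1 - 1 = m by ring, show m + 1 - 2 = m - 1 by ring] at this
    simp [hermiteDet_one_right, derivative_hermiteCoeffInt]
    push_cast at this
    linear_combination this
  | succ n =>
    have h1 := raisedDet_eq m (n + 1)
    have h2 := raisedDet_eq (m + 1) n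
    have h3 := raisedDet_mul_sub hermiteCoeffInt m n
    push_cast at h1 h2 ⊢
    unfold hermiteDet at *
    linear_combination toepDet hermiteCoeffInt (m + 1) (n + 1) * h1
      - toepDet hermiteCoeffInt m (n + 2) * h2 - ((m : ℂ[X]) + n + 2) * h3

/-- Logarithmically differentiated ratio of neighbours along a diagonal. -/
theorem wronskian_diag (m : ℤ) (n : ℕ) :
    derivative (hermiteDet (m + 1) (n + 2)) * hermiteDet m (n + 1) -
      hermiteDet (m + 1) (n + 2) * derivative (hermiteDet m (n + 1)) =
    2 * hermiteDet (m + 1) (n + 1) * hermiteDet m (n + 2) := by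
  rw [derivative_hermiteDet_succ, derivative_hermiteDet_succ]
  have := loweredDet_succ_succ_mul_sub hermiteCoeffInt m n
  unfold hermiteDet
  linear_combination 2 * this

end HermiteDeterminants

/-! ### Nonvanishing of the determinants and Toda equations. -/

section BilinearRelations

/-- The term 2Xbc has degree one above anything the Wronskian can reach. With `wronskian_antidiag`
this propagates nonvanishing to τ_{m+1,n+1} from τ_{m,n+1} and τ_{m+1,n}. -/
theorem wronskian_sub_ne_zero {b c : ℂ[X]} (hb : b ≠ 0) (hc : c ≠ 0) :
    derivative b * c - b * derivative c - 2 * X * b * c ≠ 0 := by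
  intro h
  have h' : C 2 * X * (b * c) = derivative b * c - b * derivative c := by
    rw [map_ofNat C]
    linear_combination -h
  have h1 : (C 2 * X * (b * c)).natDegree = 1 + (b.natDegree + c.natDegree) := by
    rw [natDegree_mul (by simp) (mul_ne_zero hb hc), natDegree_C_mul_X _ two_ne_zero,
      natDegree_mul hb hc]
  have h2 : (derivative b * c - b * derivative c).natDegree ≤ b.natDegree + c.natDegree := by
    refine (natDegree_sub_le _ _).trans (max_le ?_ ?_)
    · refine natDegree_mul_le.trans (Nat.add_le_add ?_ le_rfl)
      exact (natDegree_derivative_le b).trans (Nat.sub_le _ _)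
    · refine natDegree_mul_le.trans (Nat.add_le_add le_rfl ?_)
      exact (natDegree_derivative_le c).trans (Nat.sub_le _ _)
  rw [h'] at h1
  omega

theorem hermiteDet_ne_zero (m n : ℕ) : hermiteDet m n ≠ 0 := by
  induction m generalizing n with
  | zero => simp
  | succ m ihm =>
    induction n with
    | zero => simp
    | succ n ihn =>
      have h := wronskian_antidiag m n
      intro h0
      push_cast at h0 ihn
      rw [h0, mul_zero, zero_mul] at h
      exact wronskian_sub_ne_zero (ihm (n + 1)) ihn h

/-- `wronskian_right` is a formula for the difference of the logarithmic derivatives of τ_{m,n} and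
τ_{m,n+1}. Differentiating it carries the equation from n to n + 1, and `wronskian_antidiag` removes
the derivatives of the other neighbours. Clearing denominators introduces a factor A², cancelled
because A ≠ 0. The next two Toda equations use the same pattern, with induction on m and
`wronskian_left`. -/
theorem toda_left (m n : ℕ) :
    hermiteDet m n * derivative (derivative (hermiteDet m n)) - derivative (hermiteDet m n) ^ 2 +
      2 * (m : ℂ[X]) * hermiteDet m n ^ 2 =
    2 * ((m : ℂ[X]) + (n : ℂ[X])) * hermiteDet (m + 1) n * hermiteDet (m - 1) n := by
  induction n with
  | zero => simp
  | succ n ih =>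
    have h1 := wronskian_right m n
    have h1' := congrArg derivative h1
    have h2 := wronskian_antidiag m n
    have h3 := wronskian_antidiag (m - 1) n
    rw [sub_add_cancel] at h3
    simp only [derivative_mul, derivative_sub, derivative_neg, derivative_ofNat] at h1'
    push_cast at h3 ⊢
    have hA := hermiteDet_ne_zero m n
    generalize hermiteDet (m : ℤ) n = A at *
    generalize hermiteDet (m : ℤ) (n + 1) = B at *
    generalize hermiteDet ((m : ℤ) + 1) n = C at *
    generalize hermiteDet ((m : ℤ) - 1) (n + 1) = D at *
    generalize hermiteDet ((m : ℤ) + 1) (n + 1) = F at *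
    generalize hermiteDet ((m : ℤ) - 1) n = G at *
    apply mul_left_cancel₀ (pow_ne_zero 2 hA)
    push_cast at h1 h1' h2
    linear_combination B ^ 2 * ih - A * B * h1' + (derivative A * B + A * derivative B) * h1
      - 2 * A * D * h2 + 2 * B * C * h3

theorem toda_right (m n : ℕ) :
    -(hermiteDet m (n + 1) * derivative (derivative (hermiteDet m (n + 1)))) +
      derivative (hermiteDet m (n + 1)) ^ 2 +
      2 * ((n : ℂ[X]) + 1) * hermiteDet m (n + 1) ^ 2 =
    2 * ((m : ℂ[X]) + (n : ℂ[X]) + 1) * hermiteDet m (n + 2) * hermiteDet m n := by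
  induction m with
  | zero => simp
  | succ m ih =>
    have h1 := wronskian_left m n
    have h1' := congrArg derivative h1
    have h2 := wronskian_antidiag m n
    have h3 := wronskian_antidiag m (n + 1)
    simp only [derivative_mul, derivative_sub, derivative_ofNat] at h1'
    push_cast at h3 h2 ⊢
    have hA := hermiteDet_ne_zero m (n + 1)
    simp only [show n + 1 + 1 = n + 2 from rfl] at *
    generalize hermiteDet (m : ℤ) (n + 1) = A at *
    generalize hermiteDet (m : ℤ) (n + 2) = B at *
    generalize hermiteDet ((m : ℤ) + 1) (n + 1) = C at *
    generalize hermiteDet ((m : ℤ) + 1) n = E at *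
    generalize hermiteDet ((m : ℤ) + 1) (n + 2) = F at *
    generalize hermiteDet (m : ℤ) n = G at *
    apply mul_left_cancel₀ (pow_ne_zero 2 hA)
    linear_combination C ^ 2 * ih - A * C * h1' + (derivative A * C + A * derivative C) * h1
      + 2 * B * C * h2 - 2 * A * E * h3

theorem toda_antidiag (m n : ℕ) :
    hermiteDet m (n + 1) * derivative (derivative (hermiteDet m (n + 1))) -
      derivative (hermiteDet m (n + 1)) ^ 2 =
    -4 * hermiteDet (m + 1) n * hermiteDet (m - 1) (n + 2) := by
  induction m with
  | zero => simp [hermiteDet_neg_one_left]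
  | succ m ih =>
    have h1 := wronskian_left m n
    have h1' := congrArg derivative h1
    have h2 := wronskian_right m (n + 1)
    have h3 := wronskian_right (m + 1) n
    simp only [derivative_mul, derivative_sub, derivative_ofNat] at h1'
    push_cast at h3 h2 ⊢
    have hA := hermiteDet_ne_zero m (n + 1)
    simp only [show n + 1 + 1 = n + 2 from rfl, add_sub_cancel_right] at *
    generalize hermiteDet (m : ℤ) (n + 1) = A at *
    generalize hermiteDet (m : ℤ) (n + 2) = B at *
    generalize hermiteDet ((m : ℤ) + 1) (n + 1) = C at *
    generalize hermiteDet ((m : ℤ) + 1) n = E at *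
    generalize hermiteDet ((m : ℤ) + 1 + 1) n = Q at *
    generalize hermiteDet ((m : ℤ) - 1) (n + 2) = D at *
    apply mul_left_cancel₀ (pow_ne_zero 2 hA)
    linear_combination C ^ 2 * ih + A * C * h1' - (derivative A * C + A * derivative C) * h1
      - 2 * E * C * h2 + 2 * A * B * h3

end BilinearRelations

/-! ### Identification of the generalized Hermite polynomials with the determinants. -/

section GenHermite

/-- Makes the Euclidean division in the recursive definitions an exact one. -/
theorem C_mul_div_exact {u v : ℂ} {P f g : ℂ[X]} (hg : g ≠ 0) (h : P = C v * f * g) :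
    C u * (P / g) = C (u * v) * f := by
  rw [h, mul_div_cancel_right₀ _ hg, C_mul, mul_assoc]

theorem hermiteColumn_eq (m : ℕ) {b : ℂ[X]} (hb : ∃ κ : ℂ, κ ≠ 0 ∧ b = C κ * hermiteDet m 1)
    (n : ℕ) : ∃ κ : ℂ, κ ≠ 0 ∧ hermiteColumn 1 b n = C κ * hermiteDet m n := by
  induction n using Nat.twoStepInduction with
  | zero => exact ⟨1, one_ne_zero, by simp [hermiteColumn]⟩
  | one => simpa [hermiteColumn] using hb
  | more n ih0 ih1 =>
    obtain ⟨κ₀, h₀, e₀⟩ := ih0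
    obtain ⟨κ₁, h₁, e₁⟩ := ih1
    have hn : ((n : ℂ) + 1) ≠ 0 := by exact_mod_cast n.succ_ne_zero
    have hmn : ((m : ℂ) + n + 1) ≠ 0 := by exact_mod_cast (m + n).succ_ne_zero
    refine ⟨(2 * ((n : ℂ) + 1))⁻¹ * (κ₁ ^ 2 * (2 * ((m : ℂ) + n + 1)) / κ₀), ?_, ?_⟩
    · exact mul_ne_zero (inv_ne_zero (mul_ne_zero two_ne_zero ‹_›)) (div_ne_zero
        (mul_ne_zero (pow_ne_zero 2 h₁) (mul_ne_zero two_ne_zero hmn)) h₀)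
    · rw [hermiteColumn, e₀, e₁]
      refine C_mul_div_exact (mul_ne_zero (C_ne_zero.2 h₀) (hermiteDet_ne_zero m n)) ?_
      have h := toda_right m n
      have hC : C (κ₁ ^ 2 * (2 * ((m : ℂ) + n + 1)) / κ₀) * C κ₀ =
          C κ₁ ^ 2 * (2 * ((m : ℂ[X]) + (n : ℂ[X]) + 1)) := by
        rw [← C_mul, div_mul_cancel₀ _ h₀]
        simp [map_ofNat C]
      generalize κ₁ ^ 2 * (2 * ((m : ℂ) + n + 1)) / κ₀ = v at hC ⊢
      simp only [derivative_mul, derivative_C, zero_mul, zero_add]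
      have h2 : C (2 * ((n : ℂ) + 1)) = 2 * ((n : ℂ[X]) + 1) := by simp [map_ofNat C]
      rw [h2]
      linear_combination C κ₁ ^ 2 * h - hermiteDet m (n + 2) * hermiteDet m n * hC

theorem genHermite_eq (m n : ℕ) : ∃ κ : ℂ, κ ≠ 0 ∧ genHermite m n = C κ * hermiteDet m n := by
  induction m using Nat.twoStepInduction with
  | zero =>
    rw [genHermite]
    exact hermiteColumn_eq 0 ⟨1, one_ne_zero, by simp⟩ n
  | one =>
    rw [genHermite]
    refine hermiteColumn_eq 1 ⟨1, one_ne_zero, ?_⟩ n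
    rw [hermiteDet_one_right]
    change C 2 * X = C 1 * hermiteCoeff 1
    simp [hermiteCoeff, map_ofNat C]
  | more m ih0 ih1 =>
    obtain ⟨κ₀, h₀, e₀⟩ := ih0
    obtain ⟨κ₁, h₁, e₁⟩ := ih1
    have hm : ((m : ℂ) + 1) ≠ 0 := by exact_mod_cast m.succ_ne_zero
    have hmn : ((m : ℂ) + n + 1) ≠ 0 := by exact_mod_cast (m + n).succ_ne_zero
    refine ⟨(2 * ((m : ℂ) + 1))⁻¹ * (κ₁ ^ 2 * (2 * ((m : ℂ) + n + 1)) / κ₀), ?_, ?_⟩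
    · exact mul_ne_zero (inv_ne_zero (mul_ne_zero two_ne_zero ‹_›)) (div_ne_zero
        (mul_ne_zero (pow_ne_zero 2 h₁) (mul_ne_zero two_ne_zero hmn)) h₀)
    · rw [genHermite, e₀, e₁]
      refine C_mul_div_exact (mul_ne_zero (C_ne_zero.2 h₀) (hermiteDet_ne_zero m n)) ?_
      have h := toda_left (m + 1) n
      have hC : C (κ₁ ^ 2 * (2 * ((m : ℂ) + n + 1)) / κ₀) * C κ₀ =
          C κ₁ ^ 2 * (2 * ((m : ℂ[X]) + (n : ℂ[X]) + 1)) := by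
        rw [← C_mul, div_mul_cancel₀ _ h₀]
        simp [map_ofNat C]
      generalize κ₁ ^ 2 * (2 * ((m : ℂ) + n + 1)) / κ₀ = v at hC ⊢
      simp only [derivative_mul, derivative_C, zero_mul, zero_add]
      have h2 : C (2 * ((m : ℂ) + 1)) = 2 * ((m : ℂ[X]) + 1) := by simp [map_ofNat C]
      rw [h2]
      rw [show (((m + 1 : ℕ) : ℤ) - 1) = m by push_cast; ring,
        show (((m + 1 : ℕ) : ℤ) + 1) = ((m + 2 : ℕ) : ℤ) by push_cast; ring] at h
      push_cast at h ⊢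
      linear_combination C κ₁ ^ 2 * h - hermiteDet (m + 2) n * hermiteDet m n * hC

end GenHermite

/-! ### Painlevé functions as differences of logarithmic derivatives. -/

section LogDerivatives

/-- The value of the logarithmic derivative of a polynomial. -/
def polyLogDeriv (p : ℂ[X]) (y : ℂ) : ℂ := (derivative p).eval y / p.eval y

theorem logDeriv_eval (p : ℂ[X]) (y : ℂ) :
    logDeriv (fun t => p.eval t) y = polyLogDeriv p y := by
  rw [logDeriv_apply, Polynomial.deriv, polyLogDeriv]

theorem genHermite_eval_ne_zero_iff (m n : ℕ) (y : ℂ) :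
    (genHermite m n).eval y ≠ 0 ↔ (hermiteDet m n).eval y ≠ 0 := by
  obtain ⟨κ, hκ, e⟩ := genHermite_eq m n
  simp [e, hκ]

theorem polyLogDeriv_genHermite (m n : ℕ) (y : ℂ) :
    polyLogDeriv (genHermite m n) y = polyLogDeriv (hermiteDet m n) y := by
  obtain ⟨κ, hκ, e⟩ := genHermite_eq m n
  simp only [polyLogDeriv, e, derivative_C_mul, eval_mul, eval_C]
  rw [mul_div_mul_left _ _ hκ]

theorem wI_eq {m n : ℕ} {y : ℂ} (h1 : (hermiteDet (m + 1 : ℕ) n).eval y ≠ 0)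
    (h0 : (hermiteDet m n).eval y ≠ 0) :
    wI m n y = polyLogDeriv (hermiteDet (m + 1 : ℕ) n) y - polyLogDeriv (hermiteDet m n) y := by
  rw [wI, logDeriv_div y, logDeriv_eval, logDeriv_eval, polyLogDeriv_genHermite,
    polyLogDeriv_genHermite]
  · rwa [genHermite_eval_ne_zero_iff]
  · rwa [genHermite_eval_ne_zero_iff]
  · fun_prop
  · fun_prop

theorem wII_eq {m n : ℕ} {y : ℂ} (h1 : (hermiteDet m (n + 1)).eval y ≠ 0)
    (h0 : (hermiteDet m n).eval y ≠ 0) :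
    wII m n y = polyLogDeriv (hermiteDet m n) y - polyLogDeriv (hermiteDet m (n + 1)) y := by
  rw [wII, logDeriv_div y, logDeriv_eval, logDeriv_eval, polyLogDeriv_genHermite,
    polyLogDeriv_genHermite, neg_sub]
  · rwa [genHermite_eval_ne_zero_iff]
  · rwa [genHermite_eval_ne_zero_iff]
  · fun_prop
  · fun_prop

end LogDerivatives

/-! ### The symmetric form of Painlevé IV and the second-order equation. -/

section PainleveIV

theorem hasDerivAt_polyLogDeriv {p : ℂ[X]} {y : ℂ} (hp : p.eval y ≠ 0) :
    HasDerivAt (polyLogDeriv p) ((p.eval y * (derivative (derivative p)).eval y -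
      (derivative p).eval y ^ 2) / p.eval y ^ 2) y := by
  have h := ((derivative p).hasDerivAt y).div (p.hasDerivAt y) hp
  refine h.congr_deriv ?_
  ring

variable {m n : ℕ} {y : ℂ}

/-- The function `w₁` of the symmetric form of the fourth Painlevé equation. -/
def symm₁ (m n : ℕ) (y : ℂ) : ℂ :=
  polyLogDeriv (hermiteDet (m + 1) n) y - polyLogDeriv (hermiteDet m n) y

/-- The function `w₂` of the symmetric form of the fourth Painlevé equation. -/
def symm₂ (m n : ℕ) (y : ℂ) : ℂ :=
  polyLogDeriv (hermiteDet m n) y - polyLogDeriv (hermiteDet m (n + 1)) y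

/-- The function `w₃` of the symmetric form of the fourth Painlevé equation. -/
def symm₃ (m n : ℕ) (y : ℂ) : ℂ :=
  polyLogDeriv (hermiteDet m (n + 1)) y - polyLogDeriv (hermiteDet (m + 1) n) y - 2 * y

/-- This lemma and the next two compute (log τ)'' for τ_{m,n+1}, τ_{m,n+2}, τ_{m+1,n+1}. A Toda
equation makes it a quotient, which the Wronskian relations recognise, up to a constant, as a
product of two of the symmetric functions. -/
theorem hasDerivAt_base (hA : (hermiteDet m (n + 1)).eval y ≠ 0)
    (hB : (hermiteDet m (n + 2)).eval y ≠ 0) (hC : (hermiteDet (m + 1) (n + 1)).eval y ≠ 0) :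
    HasDerivAt (polyLogDeriv (hermiteDet m (n + 1)))
      (symm₁ m (n + 1) y * symm₂ m (n + 1) y) y := by
  refine (hasDerivAt_polyLogDeriv hA).congr_deriv ?_
  have h1 := congrArg (eval y) (wronskian_left m n)
  have h2 := congrArg (eval y) (wronskian_right m (n + 1))
  have h3 := congrArg (eval y) (toda_antidiag m n)
  simp only [eval_mul, eval_sub, eval_pow, eval_neg, eval_ofNat, symm₁, symm₂, polyLogDeriv,
    show n + 1 + 1 = n + 2 from rfl] at *
  rw [div_sub_div _ _ hC hA, div_sub_div _ _ hA hB, h1, h2, h3]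
  field_simp
  ring

theorem hasDerivAt_right (hA : (hermiteDet m (n + 1)).eval y ≠ 0)
    (hB : (hermiteDet m (n + 2)).eval y ≠ 0) (hC : (hermiteDet (m + 1) (n + 1)).eval y ≠ 0) :
    HasDerivAt (polyLogDeriv (hermiteDet m (n + 2)))
      (symm₂ m (n + 1) y * symm₃ m (n + 1) y - 2 * m) y := by
  refine (hasDerivAt_polyLogDeriv hB).congr_deriv ?_
  have h1 := congrArg (eval y) (wronskian_antidiag m (n + 1))
  have h2 := congrArg (eval y) (wronskian_right m (n + 1))
  have h3 := congrArg (eval y) (toda_left m (n + 2))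
  push_cast at h1 h2 h3
  simp only [eval_mul, eval_add, eval_sub, eval_pow, eval_neg, eval_ofNat, eval_natCast, eval_X,
    eval_one, symm₃, symm₂, polyLogDeriv, show n + 1 + 1 = n + 2 from rfl] at *
  rw [div_sub_div _ _ hB hC, div_sub_div _ _ hA hB, h2]
  generalize eval y (hermiteDet (m : ℤ) (n + 1)) = A at *
  generalize eval y (hermiteDet (m : ℤ) (n + 2)) = B at *
  generalize eval y (hermiteDet ((m : ℤ) + 1) (n + 1)) = C at *
  rw [sub_eq_iff_eq_add.1 h1]
  field_simp
  linear_combination A * h3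

theorem hasDerivAt_left (hA : (hermiteDet m (n + 1)).eval y ≠ 0)
    (hB : (hermiteDet m (n + 2)).eval y ≠ 0) (hC : (hermiteDet (m + 1) (n + 1)).eval y ≠ 0) :
    HasDerivAt (polyLogDeriv (hermiteDet (m + 1) (n + 1)))
      (symm₁ m (n + 1) y * symm₃ m (n + 1) y + 2 * (n + 1)) y := by
  refine (hasDerivAt_polyLogDeriv hC).congr_deriv ?_
  have h1 := congrArg (eval y) (wronskian_antidiag m (n + 1))
  have h2 := congrArg (eval y) (wronskian_left m n)
  have h3 := congrArg (eval y) (toda_right (m + 1) n)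
  push_cast at h1 h2 h3
  simp only [eval_mul, eval_add, eval_sub, eval_pow, eval_neg, eval_ofNat, eval_natCast, eval_X,
    eval_one, symm₃, symm₁, polyLogDeriv, show n + 1 + 1 = n + 2 from rfl] at *
  rw [div_sub_div _ _ hB hC, div_sub_div _ _ hC hA, h2]
  generalize eval y (hermiteDet (m : ℤ) (n + 1)) = A at *
  generalize eval y (hermiteDet (m : ℤ) (n + 2)) = B at *
  generalize eval y (hermiteDet ((m : ℤ) + 1) (n + 1)) = C at *
  rw [sub_eq_iff_eq_add.1 h1]
  field_simp
  linear_combination -A * h3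

theorem hasDerivAt_symm₂ (hA : (hermiteDet m (n + 1)).eval y ≠ 0)
    (hB : (hermiteDet m (n + 2)).eval y ≠ 0) (hC : (hermiteDet (m + 1) (n + 1)).eval y ≠ 0) :
    HasDerivAt (symm₂ m (n + 1))
      (symm₂ m (n + 1) y * (symm₁ m (n + 1) y - symm₃ m (n + 1) y) + 2 * m) y := by
  refine ((hasDerivAt_base hA hB hC).sub (hasDerivAt_right hA hB hC)).congr_deriv ?_
  ring

theorem hasDerivAt_symm₁_sub_symm₃ (hA : (hermiteDet m (n + 1)).eval y ≠ 0)
    (hB : (hermiteDet m (n + 2)).eval y ≠ 0) (hC : (hermiteDet (m + 1) (n + 1)).eval y ≠ 0) :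
    HasDerivAt (fun t => symm₁ m (n + 1) t - symm₃ m (n + 1) t)
      (2 * symm₁ m (n + 1) y * symm₃ m (n + 1) y - symm₂ m (n + 1) y *
        (symm₁ m (n + 1) y + symm₃ m (n + 1) y) + 2 * m + 4 * (n + 1) + 2) y := by
  have hA' := hasDerivAt_base hA hB hC
  have hB' := hasDerivAt_right hA hB hC
  have hC' := hasDerivAt_left hA hB hC
  refine ((hC'.sub hA').sub ((hB'.sub hC').sub ((hasDerivAt_id y).const_mul 2))).congr_deriv ?_
  ring

/-- The fourth Painlevé equation with `α = -(m + 2 n + 1)` and `β = -2 m ^ 2`. -/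
def IsPainleveIVAt (m n : ℕ) (w : ℂ → ℂ) (y : ℂ) : Prop :=
  w y * deriv (deriv w) y = deriv w y ^ 2 / 2 + 3 / 2 * w y ^ 4 + 4 * y * w y ^ 3 +
    (2 * y ^ 2 + 2 * m + 4 * n + 2) * w y ^ 2 - 2 * m ^ 2

/-- Differentiate w₂' = w₂ (w₁ - w₃) + 2m once more and eliminate w₃ through w₁ + w₂ + w₃ = -2y;
what remains is a polynomial identity in w₁, w₂ and y. -/
theorem painleveIV_symm₂_of_ne_zero (hA : (hermiteDet m (n + 1)).eval y ≠ 0)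
    (hB : (hermiteDet m (n + 2)).eval y ≠ 0) (hC : (hermiteDet (m + 1) (n + 1)).eval y ≠ 0) :
    IsPainleveIVAt m (n + 1) (symm₂ m (n + 1)) y := by
  have hnhds : ∀ p : ℂ[X], p.eval y ≠ 0 → ∀ᶠ t in 𝓝 y, p.eval t ≠ 0 := fun p hp =>
    p.continuous.continuousAt.eventually_ne hp
  have hderiv : deriv (symm₂ m (n + 1)) =ᶠ[𝓝 y] fun t =>
      symm₂ m (n + 1) t * (symm₁ m (n + 1) t - symm₃ m (n + 1) t) + 2 * m := by
    filter_upwards [hnhds _ hA, hnhds _ hB, hnhds _ hC] with t tA tB tC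
    exact (hasDerivAt_symm₂ tA tB tC).deriv
  have h1 := hasDerivAt_symm₂ hA hB hC
  have h2 := ((h1.mul (hasDerivAt_symm₁_sub_symm₃ hA hB hC)).add_const (2 * (m : ℂ))).deriv
  have hsum : symm₁ m (n + 1) y + symm₃ m (n + 1) y = -2 * y - symm₂ m (n + 1) y := by
    simp only [symm₁, symm₂, symm₃]; ring
  unfold IsPainleveIVAt
  rw [hderiv.deriv_eq, h1.deriv]
  refine (congrArg _ h2).trans ?_
  have h3 : symm₃ m (n + 1) y = -2 * y - symm₂ m (n + 1) y - symm₁ m (n + 1) y := by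
    linear_combination hsum
  rw [h3]
  push_cast
  ring

theorem analyticAt_symm₂ (hA : (hermiteDet m n).eval y ≠ 0)
    (hB : (hermiteDet m (n + 1)).eval y ≠ 0) : AnalyticAt ℂ (symm₂ m n) y := by
  have hp : ∀ p : ℂ[X], AnalyticAt ℂ (fun t => p.eval t) y := fun p =>
    p.differentiable.analyticAt y
  exact ((hp _).div (hp _) hA).sub ((hp _).div (hp _) hB)

/-- Zeros of τ_{m+1,n+1} do not affect w₂, and the equation extends across them by continuity. This
is needed because the pole-free region controls only the two determinants that occur in w₂. -/
theorem painleveIV_symm₂ (hA : (hermiteDet m (n + 1)).eval y ≠ 0)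
    (hB : (hermiteDet m (n + 2)).eval y ≠ 0) : IsPainleveIVAt m (n + 1) (symm₂ m (n + 1)) y := by
  have hw := analyticAt_symm₂ hA hB
  have hC : ∀ᶠ t in 𝓝[≠] y, (hermiteDet (m + 1) (n + 1)).eval t ≠ 0 := by
    have hfin := (hermiteDet (m + 1) (n + 1)).roots.toFinset.finite_toSet
    have h0 : hermiteDet ((m : ℤ) + 1) (n + 1) ≠ 0 := by
      exact_mod_cast hermiteDet_ne_zero (m + 1) (n + 1)
    have h1 := (hfin.subset (Set.sdiff_subset (t := {y}))).isClosed.isOpen_compl.mem_nhds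
      (x := y) (by simp)
    filter_upwards [mem_nhdsWithin_of_mem_nhds h1, self_mem_nhdsWithin] with t ht hty h
    refine ht ⟨?_, hty⟩
    simp [h0, h]
  have hc0 : ContinuousAt (symm₂ m (n + 1)) y := hw.continuousAt
  have hc1 : ContinuousAt (deriv (symm₂ m (n + 1))) y := hw.deriv.continuousAt
  have hc2 : ContinuousAt (deriv (deriv (symm₂ m (n + 1)))) y := hw.deriv.deriv.continuousAt
  have hev : ∀ᶠ t in 𝓝[≠] y, IsPainleveIVAt m (n + 1) (symm₂ m (n + 1)) t := by
    filter_upwards [hC, mem_nhdsWithin_of_mem_nhds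
        ((hermiteDet m (n + 1)).continuous.continuousAt.eventually_ne hA),
      mem_nhdsWithin_of_mem_nhds
        ((hermiteDet m (n + 2)).continuous.continuousAt.eventually_ne hB)] with t tC tA tB
    exact painleveIV_symm₂_of_ne_zero tA tB tC
  unfold IsPainleveIVAt at hev ⊢
  refine tendsto_nhds_unique_of_eventuallyEq
    (ContinuousAt.tendsto (x := y) ?_ |>.mono_left nhdsWithin_le_nhds)
    (ContinuousAt.tendsto (x := y) ?_ |>.mono_left nhdsWithin_le_nhds) hev
  · fun_prop
  · fun_prop

end PainleveIV

/-! ### Uniform bounds for holomorphic solutions of the rescaled equation. -/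

section PoleFreeEstimates

/-- The polynomial part of the rescaled fourth Painlevé equation. -/
def scaledPoly (e : ℝ) (t v : ℂ) : ℂ :=
  3 / 2 * v ^ 4 + 4 * t * v ^ 3 + (2 * t ^ 2 + 2 + e) * v ^ 2 - 2

/-- The rescaled fourth Painlevé equation, with large parameter `M`. -/
def IsScaledPainleveIVAt (M e : ℝ) (g : ℂ → ℂ) (t : ℂ) : Prop :=
  g t * deriv (deriv g) t - deriv g t ^ 2 / 2 = M ^ 2 * scaledPoly e t (g t)

theorem norm_deriv_deriv_le {g : ℂ → ℂ} {t : ℂ} {d B : ℝ} (hd : 0 < d)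
    (hg : DiffContOnCl ℂ g (Metric.ball t d)) (hB : ∀ s ∈ Metric.closedBall t d, ‖g s‖ ≤ B) :
    ‖deriv g t‖ ≤ B / d ∧ ‖deriv (deriv g) t‖ ≤ 2 * B / d ^ 2 := by
  have hs : ∀ s ∈ Metric.sphere t d, ‖g s‖ ≤ B := fun s hs =>
    hB s (Metric.sphere_subset_closedBall hs)
  refine ⟨Complex.norm_deriv_le_of_forall_mem_sphere_norm_le hd hg hs, ?_⟩
  have h := Complex.norm_iteratedDeriv_le_of_forall_mem_sphere_norm_le 2 hd hg hs
  rw [iteratedDeriv_succ, iteratedDeriv_one] at h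
  simpa [Nat.factorial] using h

theorem norm_scaledPoly_le {M e : ℝ} {g : ℂ → ℂ} {t : ℂ} {d B F : ℝ} (hM : 0 < M) (hd : 0 < d)
    (hg : DiffContOnCl ℂ g (Metric.ball t d)) (hB : ∀ s ∈ Metric.closedBall t d, ‖g s‖ ≤ B)
    (hF : ‖g t‖ ≤ F) (hode : IsScaledPainleveIVAt M e g t) :
    ‖scaledPoly e t (g t)‖ ≤ (F * (2 * B) + B ^ 2 / 2) / d ^ 2 / M ^ 2 := by
  obtain ⟨h1, h2⟩ := norm_deriv_deriv_le hd hg hB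
  rw [le_div_iff₀ (by positivity)]
  have h : ‖scaledPoly e t (g t)‖ * M ^ 2 = ‖g t * deriv (deriv g) t - deriv g t ^ 2 / 2‖ := by
    rw [hode, norm_mul, norm_pow, Complex.norm_real, Real.norm_eq_abs, sq_abs, mul_comm]
  have hF0 : 0 ≤ F := (norm_nonneg _).trans hF
  rw [h]
  calc _ ≤ ‖g t‖ * ‖deriv (deriv g) t‖ + ‖deriv g t‖ ^ 2 / 2 := by
        refine (norm_sub_le _ _).trans_eq ?_
        simp
    _ ≤ F * (2 * B / d ^ 2) + (B / d) ^ 2 / 2 := by gcongr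
    _ = _ := by field_simp

/-- The source of upper bounds: the quartic term dominates for large `v`. The constant 8 is 2 + 6,
by `e ≤ 6`. -/
theorem norm_pow_four_le {e τ : ℝ} {t v : ℂ} (he : 0 ≤ e) (he' : e ≤ 6) (ht : ‖t‖ ≤ τ) :
    3 / 2 * ‖v‖ ^ 4 ≤
      ‖scaledPoly e t v‖ + 4 * τ * ‖v‖ ^ 3 + (2 * τ ^ 2 + 8) * ‖v‖ ^ 2 + 2 := by
  have h : 3 / 2 * v ^ 4 = scaledPoly e t v - 4 * t * v ^ 3 - (2 * t ^ 2 + 2 + e) * v ^ 2 + 2 := by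
    unfold scaledPoly; ring
  have h' : 3 / 2 * ‖v‖ ^ 4 = ‖3 / 2 * v ^ 4‖ := by simp
  have hc : ‖2 * t ^ 2 + 2 + (e : ℂ)‖ ≤ 2 * τ ^ 2 + 8 := by
    refine (norm_add₃_le).trans ?_
    rw [Complex.norm_real, Real.norm_eq_abs, abs_of_nonneg he, norm_mul, norm_pow]
    have : ‖t‖ ^ 2 ≤ τ ^ 2 := by gcongr
    simp only [Complex.norm_ofNat]
    linarith
  rw [h', h]
  refine (norm_add_le _ _).trans ?_
  rw [Complex.norm_ofNat]
  gcongr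
  refine (norm_sub_le _ _).trans ?_
  refine add_le_add ((norm_sub_le _ _).trans (add_le_add le_rfl ?_)) ?_
  · rw [norm_mul, norm_mul, norm_pow, Complex.norm_ofNat]
    gcongr
  · rw [norm_mul, norm_pow]
    gcongr

/-- The source of lower bounds: the constant term -2 dominates for small `v`. -/
theorem two_le_norm_scaledPoly {e τ : ℝ} {t v : ℂ} (he : 0 ≤ e) (he' : e ≤ 6) (ht : ‖t‖ ≤ τ)
    (hv : ‖v‖ ≤ 1) :
    2 ≤ ‖scaledPoly e t v‖ + (2 + 4 * τ + (2 * τ ^ 2 + 8)) * ‖v‖ := by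
  have h : (2 : ℂ) = -scaledPoly e t v + (3 / 2 * v ^ 4 + 4 * t * v ^ 3 +
      (2 * t ^ 2 + 2 + e) * v ^ 2) := by
    unfold scaledPoly; ring
  have hc : ‖2 * t ^ 2 + 2 + (e : ℂ)‖ ≤ 2 * τ ^ 2 + 8 := by
    refine (norm_add₃_le).trans ?_
    rw [Complex.norm_real, Real.norm_eq_abs, abs_of_nonneg he, norm_mul, norm_pow]
    have : ‖t‖ ^ 2 ≤ τ ^ 2 := by gcongr
    simp only [Complex.norm_ofNat]
    linarith
  have hτ : 0 ≤ τ := (norm_nonneg _).trans ht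
  have hp : ∀ k : ℕ, k ≠ 0 → ‖v‖ ^ k ≤ ‖v‖ := fun k hk =>
    pow_le_of_le_one (norm_nonneg _) hv hk
  have h2 : (2 : ℝ) = ‖(2 : ℂ)‖ := by simp
  conv_lhs => rw [h2, h]
  refine (norm_add_le _ _).trans ?_
  rw [norm_neg]
  gcongr
  refine le_of_le_of_eq ?_ (show 2 * ‖v‖ + 4 * τ * ‖v‖ + (2 * τ ^ 2 + 8) * ‖v‖ = _ by ring)
  refine norm_add₃_le.trans ?_
  simp only [norm_mul, norm_pow, norm_div, Complex.norm_ofNat]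
  gcongr
  · norm_num
  · exact hp 4 (by norm_num)
  · exact hp 3 (by norm_num)
  · exact hp 2 (by norm_num)

/-- A bound for solutions of the rescaled equation which are holomorphic in a disc: at a maximum of
`‖g t‖ * dist t (boundary)`, Cauchy's estimates make the derivatives negligible. -/
theorem exists_bound_of_scaledPainleveIV (x : ℂ) {r : ℝ} (hr : 0 < r) :
    ∃ G : ℝ, 0 < G ∧ ∀ (M e : ℝ) (g : ℂ → ℂ), 1 ≤ M → 0 ≤ e → e ≤ 6 →
      DifferentiableOn ℂ g (Metric.ball x (2 * r)) →
      (∀ t ∈ Metric.ball x (2 * r), IsScaledPainleveIVAt M e g t) →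
      ∀ t ∈ Metric.closedBall x (r / 2), ‖g t‖ ≤ G := by
  set τ := ‖x‖ + r with hτ
  have hτ0 : 0 ≤ τ := by positivity
  set Q := 6 + 4 * τ * r + (2 * τ ^ 2 + 8) * r ^ 2 + 2 * r ^ 4 with hQ
  have hQ0 : 0 < Q := by positivity
  refine ⟨4 * (1 + Q) / r, by positivity, ?_⟩
  intro M e g hM he he' hg hode t ht
  have hcont : ContinuousOn (fun s => ‖g s‖ * (r - dist s x)) (Metric.closedBall x r) := by
    refine ContinuousOn.mul ?_ (by fun_prop)
    exact (hg.continuousOn.mono (Metric.closedBall_subset_ball (by linarith))).norm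
  obtain ⟨t₀, ht₀, hmax⟩ := (isCompact_closedBall x r).exists_isMaxOn
    ⟨x, Metric.mem_closedBall_self hr.le⟩ hcont
  set F := ‖g t₀‖ with hF
  set d := (r - dist t₀ x) / 2 with hd
  have hdist₀ : dist t₀ x ≤ r := ht₀
  have hmax' : ∀ s ∈ Metric.closedBall x r, ‖g s‖ * (r - dist s x) ≤ F * (2 * d) := by
    intro s hs
    have := hmax hs
    simp only [Set.mem_ofPred_eq] at this
    rw [show 2 * d = r - dist t₀ x by rw [hd]; ring]
    exact this
  have hP : F * d ≤ 1 + Q := by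
    rcases (show 0 ≤ d by rw [hd]; linarith).eq_or_lt with hd0 | hd0
    · rw [← hd0]; linarith
    have hsub : Metric.closedBall t₀ d ⊆ Metric.closedBall x (r - d) := by
      intro s hs
      rw [Metric.mem_closedBall] at *
      have := dist_triangle s t₀ x
      linarith
    -- Points within `d` of `t₀` keep at least half of its distance to the boundary, so maximality
    -- of the weighted norm loses only a factor 2.
    have hB : ∀ s ∈ Metric.closedBall t₀ d, ‖g s‖ ≤ 2 * F := by
      intro s hs
      have h1 : dist s x ≤ r - d := hsub hs
      have h2 := hmax' s (by rw [Metric.mem_closedBall]; linarith)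
      have h3 : ‖g s‖ * d ≤ ‖g s‖ * (r - dist s x) := by gcongr; linarith
      have : ‖g s‖ * d ≤ 2 * F * d := by linarith
      exact le_of_mul_le_mul_right this hd0
    have hball : Metric.closedBall t₀ d ⊆ Metric.ball x (2 * r) :=
      hsub.trans (Metric.closedBall_subset_ball (by linarith))
    have hdc : DiffContOnCl ℂ g (Metric.ball t₀ d) := (hg.mono hball).diffContOnCl_ball subset_rfl
    have h1 := norm_scaledPoly_le (F := F) (by linarith) hd0 hdc hB le_rfl
      (hode t₀ (hball (Metric.mem_closedBall_self hd0.le)))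
    have ht₀n : ‖t₀‖ ≤ τ := by
      have := norm_le_norm_add_norm_sub' t₀ x
      rw [← dist_eq_norm] at this
      linarith
    have h2 := norm_pow_four_le (v := g t₀) he he' ht₀n
    have h3 : ‖scaledPoly e t₀ (g t₀)‖ ≤ 6 * F ^ 2 / d ^ 2 := by
      refine h1.trans ?_
      rw [show (F * (2 * (2 * F)) + (2 * F) ^ 2 / 2) = 6 * F ^ 2 by ring]
      exact div_le_self (by positivity) (one_le_pow₀ hM)
    have hF0 : 0 ≤ F := norm_nonneg _
    have hdr : d ≤ r := by rw [hd]; linarith [dist_nonneg (x := t₀) (y := x)]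
    -- If P = F d exceeded 1 + Q, the quartic inequality multiplied by d⁴ would give 3/2 P⁴ ≤ Q P³,
    -- using P ≥ 1 and d ≤ r, hence P ≤ 2Q/3.
    by_contra! hlt
    set P := F * d with hPdef
    have hP1 : 1 ≤ P := by linarith
    have h4 : 3 / 2 * P ^ 4 ≤ 6 * P ^ 2 + 4 * τ * d * P ^ 3 + (2 * τ ^ 2 + 8) * d ^ 2 * P ^ 2
        + 2 * d ^ 4 := by
      have h5 : 3 / 2 * F ^ 4 ≤ 6 * F ^ 2 / d ^ 2 + 4 * τ * F ^ 3 + (2 * τ ^ 2 + 8) * F ^ 2 + 2 := by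
        linarith
      calc 3 / 2 * P ^ 4 = (3 / 2 * F ^ 4) * d ^ 4 := by rw [hPdef]; ring
        _ ≤ _ := mul_le_mul_of_nonneg_right h5 (by positivity)
        _ = _ := by rw [hPdef]; field_simp
    have h6 : 3 / 2 * P ^ 4 ≤ Q * P ^ 3 := by
      refine h4.trans ?_
      have p2 : P ^ 2 ≤ P ^ 3 := pow_le_pow_right₀ hP1 (by norm_num)
      have p0 : 1 ≤ P ^ 3 := one_le_pow₀ hP1
      calc _ ≤ 6 * P ^ 3 + 4 * τ * r * P ^ 3 + (2 * τ ^ 2 + 8) * r ^ 2 * P ^ 3 +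
            2 * r ^ 4 * P ^ 3 := by
            have : 2 * d ^ 4 ≤ 2 * r ^ 4 * P ^ 3 := by
              calc 2 * d ^ 4 ≤ 2 * r ^ 4 * 1 := by rw [mul_one]; gcongr
                _ ≤ _ := by gcongr
            gcongr
        _ = _ := by rw [hQ]; ring
    have h7 : 3 / 2 * P ≤ Q := by
      have : 3 / 2 * P * P ^ 3 ≤ Q * P ^ 3 := by linarith [h6]
      exact le_of_mul_le_mul_right this (by positivity)
    linarith
  have ht' : dist t x ≤ r / 2 := ht
  have h1 := hmax' t (by rw [Metric.mem_closedBall]; linarith)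
  have h2 : ‖g t‖ * (r / 2) ≤ ‖g t‖ * (r - dist t x) := by gcongr; linarith
  rw [le_div_iff₀ hr]
  linarith

/-- Holomorphic solutions of the rescaled equation vary by a factor `1 + O (1 / M)` over distances
`O (1 / M)`. -/
theorem exists_ratio_estimate (x : ℂ) {r : ℝ} (hr : 0 < r) :
    ∃ K M₀ : ℝ, 0 < K ∧ 1 ≤ M₀ ∧ ∀ (M e : ℝ) (g : ℂ → ℂ), M₀ ≤ M → 0 ≤ e → e ≤ 6 →
      DifferentiableOn ℂ g (Metric.ball x (2 * r)) →
      (∀ t ∈ Metric.ball x (2 * r), IsScaledPainleveIVAt M e g t) →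
      ∀ t, ‖x - t‖ ≤ ‖x‖ / M → g t ≠ 0 ∧ ‖g x / g t - 1‖ ≤ K / M := by
  obtain ⟨G, hG, hbound⟩ := exists_bound_of_scaledPainleveIV x hr
  set τ := ‖x‖ + r with hτ
  set Q := 2 + 4 * τ + (2 * τ ^ 2 + 8) with hQ
  have hQ2 : 2 ≤ Q := by
    have : 0 ≤ τ := by positivity
    nlinarith
  set S := (G * (2 * G) + G ^ 2 / 2) / (r / 4) ^ 2 with hS
  have hS0 : 0 < S := by positivity
  set L := G / (r / 4) with hL
  have hL0 : 0 < L := by positivity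
  -- The threshold for M serves two purposes: S / M² < 1 for the lower bound on g, and ‖x‖ / M ≤ r /
  -- 4 so that t stays in the disc.
  refine ⟨(L * ‖x‖ + 1) * Q, 1 + S + 4 * ‖x‖ / r, by positivity, by
    have : 0 ≤ 4 * ‖x‖ / r := by positivity
    linarith, ?_⟩
  intro M e g hM he he' hg hode
  have hx0 : 0 ≤ 4 * ‖x‖ / r := by positivity
  have hM1 : 1 ≤ M := by linarith
  have hM0 : 0 < M := by linarith
  have hb := hbound M e g hM1 he he' hg hode
  have hsub : ∀ t ∈ Metric.closedBall x (r / 4), Metric.closedBall t (r / 4) ⊆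
      Metric.closedBall x (r / 2) := by
    intro t ht s hs
    rw [Metric.mem_closedBall] at *
    have := dist_triangle s t x
    linarith
  have hdc : ∀ t ∈ Metric.closedBall x (r / 4), DiffContOnCl ℂ g (Metric.ball t (r / 4)) :=
    fun t ht => (hg.mono ((hsub t ht).trans
      (Metric.closedBall_subset_ball (by linarith)))).diffContOnCl_ball subset_rfl
  have hL' : ∀ t ∈ Metric.closedBall x (r / 4), ‖deriv g t‖ ≤ L := fun t ht =>
    (norm_deriv_deriv_le (by positivity) (hdc t ht) fun s hs => hb s (hsub t ht hs)).1
  -- A value below 1 / Q would make `scaledPoly` exceed 1 in norm, while the equation and Cauchy's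
  -- estimates bound it by S / M² < 1.
  have hlow : ∀ t ∈ Metric.closedBall x (r / 4), 1 / Q ≤ ‖g t‖ := by
    intro t ht
    have ht' : dist t x ≤ r / 4 := ht
    by_contra! hlt
    have h1 := norm_scaledPoly_le hM0 (by positivity) (hdc t ht)
      (fun s hs => hb s (hsub t ht hs)) (hb t (hsub t ht (Metric.mem_closedBall_self (by linarith))))
      (hode t (by rw [Metric.mem_ball]; linarith))
    have htn : ‖t‖ ≤ τ := by
      have := norm_le_norm_add_norm_sub' t x
      rw [← dist_eq_norm] at this
      linarith
    have hv : ‖g t‖ ≤ 1 := hlt.le.trans (by rw [div_le_one] <;> linarith)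
    have h2 := two_le_norm_scaledPoly he he' htn hv
    have h3 : Q * ‖g t‖ < 1 := by rwa [lt_div_iff₀' (by linarith)] at hlt
    have h4 : S / M ^ 2 < 1 := by
      rw [div_lt_one (by positivity)]
      nlinarith
    linarith
  intro t ht
  have htx : ‖x‖ / M ≤ r / 4 := by
    rw [div_le_iff₀ hM0]
    have : 4 * ‖x‖ / r ≤ M := by linarith
    rw [div_le_iff₀ hr] at this
    linarith
  have htm : t ∈ Metric.closedBall x (r / 4) := by
    rw [Metric.mem_closedBall, dist_comm, dist_eq_norm]
    linarith
  have hxm : x ∈ Metric.closedBall x (r / 4) := Metric.mem_closedBall_self (by linarith)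
  have hgt := hlow t htm
  have hQ0 : 0 < 1 / Q := by positivity
  have hne : g t ≠ 0 := norm_pos_iff.1 (hQ0.trans_le hgt)
  refine ⟨hne, ?_⟩
  have hdiff : ‖g x - g t‖ ≤ L * ‖x - t‖ := by
    refine (convex_closedBall x (r / 4)).norm_image_sub_le_of_norm_deriv_le (𝕜 := ℂ)
      (fun s hs => ?_) hL' htm hxm
    refine (hg s (Metric.closedBall_subset_ball (by linarith) hs)).differentiableAt ?_
    exact Metric.isOpen_ball.mem_nhds (Metric.closedBall_subset_ball (by linarith) hs)
  rw [div_sub_one hne, norm_div]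
  calc ‖g x - g t‖ / ‖g t‖ ≤ (L * (‖x‖ / M)) / (1 / Q) := by
        gcongr
        exact hdiff.trans (by gcongr)
    _ = L * ‖x‖ * Q / M := by field_simp
    _ ≤ _ := by gcongr; linarith

end PoleFreeEstimates

/-! ### Scaling by the square root of the first index and comparison of the two arguments. -/

section Rescaling

theorem sqrtN_sq (k : ℕ) : sqrtN k ^ 2 = k := by
  unfold sqrtN
  rw [← Complex.ofReal_pow, Real.sq_sqrt (Nat.cast_nonneg k), Complex.ofReal_natCast]

theorem sqrtN_ne_zero {k : ℕ} (hk : k ≠ 0) : sqrtN k ≠ 0 := by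
  intro h
  have := sqrtN_sq k
  rw [h] at this
  simp [eq_comm, hk] at this

/-- The second symmetric function in the variable in which its poles fill a fixed region. -/
def scaledSymm₂ (m n : ℕ) (t : ℂ) : ℂ := symm₂ m n (sqrtN m * t) / sqrtN m

theorem deriv_comp_mul_div (f : ℂ → ℂ) {s : ℂ} (hs : s ≠ 0) :
    deriv (fun t => f (s * t) / s) = fun t => deriv f (s * t) := by
  ext t
  rw [deriv_div_const, deriv_comp_mul_left, smul_eq_mul, mul_div_cancel_left₀ _ hs]

theorem isScaledPainleveIVAt_scaledSymm₂ {m n : ℕ} (hm : m ≠ 0) {t : ℂ}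
    (hA : (hermiteDet m (n + 1)).eval (sqrtN m * t) ≠ 0)
    (hB : (hermiteDet m (n + 2)).eval (sqrtN m * t) ≠ 0) :
    IsScaledPainleveIVAt m ((4 * (n + 1) + 2) / m) (scaledSymm₂ m (n + 1)) t := by
  have h := painleveIV_symm₂ hA hB
  have hs := sqrtN_ne_zero hm
  have hs2 := sqrtN_sq m
  have hm' : (m : ℂ) ≠ 0 := by exact_mod_cast hm
  have hd : deriv (scaledSymm₂ m (n + 1)) = fun t => deriv (symm₂ m (n + 1)) (sqrtN m * t) :=
    deriv_comp_mul_div _ hs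
  unfold IsPainleveIVAt at h
  unfold IsScaledPainleveIVAt scaledPoly
  rw [hd, deriv_comp_mul_left, smul_eq_mul]
  simp only [scaledSymm₂]
  generalize symm₂ m (n + 1) (sqrtN m * t) = w at *
  generalize deriv (deriv (symm₂ m (n + 1))) (sqrtN m * t) = w'' at *
  generalize deriv (symm₂ m (n + 1)) (sqrtN m * t) = w' at *
  generalize sqrtN m = s at *
  push_cast at h ⊢
  rw [← hs2] at h hm' ⊢
  field_simp
  linear_combination 2 * h

theorem differentiableAt_scaledSymm₂ {m n : ℕ} {t : ℂ}
    (hA : (hermiteDet m n).eval (sqrtN m * t) ≠ 0)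
    (hB : (hermiteDet m (n + 1)).eval (sqrtN m * t) ≠ 0) :
    DifferentiableAt ℂ (scaledSymm₂ m n) t := by
  have h := (analyticAt_symm₂ hA hB).differentiableAt
  have h' : DifferentiableAt ℂ (fun t => symm₂ m n (sqrtN m * t)) t :=
    DifferentiableAt.comp t h (by fun_prop)
  exact h'.div_const _

theorem wII_eq_scaledSymm₂ {m n : ℕ} (hm : m ≠ 0) {t : ℂ}
    (hA : (hermiteDet m n).eval (sqrtN m * t) ≠ 0)
    (hB : (hermiteDet m (n + 1)).eval (sqrtN m * t) ≠ 0) :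
    wII m n (sqrtN m * t) = sqrtN m * scaledSymm₂ m n t := by
  rw [wII_eq hB hA, scaledSymm₂, mul_div_cancel₀ _ (sqrtN_ne_zero hm)]
  rfl

/-- For u = m / (m + 1) ≤ 1 one has u ≤ √u, hence 1 - √u ≤ 1 - u = 1 / (m + 1). -/
theorem sqrtN_div_estimate (m : ℕ) (x : ℂ) :
    ‖x - sqrtN m / sqrtN (m + 1) * x‖ ≤ ‖x‖ / (m + 1 : ℕ) := by
  set u : ℝ := (m : ℝ) / ((m + 1 : ℕ) : ℝ) with hu
  have hM : (0 : ℝ) < ((m + 1 : ℕ) : ℝ) := by positivity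
  have hu0 : 0 ≤ u := by positivity
  have hu1 : u ≤ 1 := by
    rw [hu, div_le_one hM]; push_cast; linarith
  have h1 : u ≤ √u := by
    refine Real.le_sqrt_of_sq_le ?_
    nlinarith
  have h2 : √u ≤ 1 := Real.sqrt_le_one.2 hu1
  have h3 : x - sqrtN m / sqrtN (m + 1) * x = ((1 - √u : ℝ) : ℂ) * x := by
    rw [hu, Real.sqrt_div (Nat.cast_nonneg m)]
    simp only [sqrtN]
    push_cast
    ring
  have h4 : 1 - √u ≤ 1 / ((m + 1 : ℕ) : ℝ) := by
    have : 1 - u = 1 / ((m + 1 : ℕ) : ℝ) := by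
      rw [hu]; field_simp; push_cast; ring
    linarith
  rw [h3, norm_mul, Complex.norm_real, Real.norm_eq_abs, abs_of_nonneg (by linarith)]
  calc _ ≤ 1 / ((m + 1 : ℕ) : ℝ) * ‖x‖ := by gcongr
    _ = _ := by ring

/-- In the pole-free region, the functions of the second type at the arguments `(m + 1)^{1/2} x`
and `m^{1/2} x` differ by a factor `1 + O (1 / m)`. -/
theorem exists_wII_ratio_estimate {p q : ℕ} (hq : 1 ≤ q) (hqp : q ≤ p) {x : ℂ}
    (hx : InPoleFreeRegion p q x) :
    ∃ (K : ℝ) (J : ℕ), 1 ≤ J ∧ ∀ j : ℕ, J ≤ j → ∀ m n : ℕ, m = j * p → n = j * q →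
      (genHermite (m + 1) n).eval (sqrtN m * x) ≠ 0 ∧
      (genHermite (m + 1) (n + 1)).eval (sqrtN m * x) ≠ 0 ∧
      ∃ ε : ℂ, ‖ε‖ ≤ K / (m : ℝ) ∧
        wII (m + 1) n (sqrtN (m + 1) * x) = wII (m + 1) n (sqrtN m * x) * (1 + ε) := by
  obtain ⟨δ, hδ, hev⟩ := hx
  obtain ⟨K, M₀, hK, hM₀, hest⟩ := exists_ratio_estimate x (r := δ / 2) (by positivity)
  obtain ⟨J, hJ⟩ := eventually_atTop.1 hev
  refine ⟨K, J + ⌈M₀⌉₊ + ⌈‖x‖ / δ⌉₊ + 1, by omega, ?_⟩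
  intro j hj m n hm hn
  have hne := hJ j (by omega)
  rw [← hm, ← hn] at hne
  have hjm : j ≤ m := by rw [hm]; exact Nat.le_mul_of_pos_right j (by omega)
  have hnm : n ≤ m := by rw [hm, hn]; exact Nat.mul_le_mul le_rfl hqp
  have hn1 : 1 ≤ n := by rw [hn]; exact Nat.mul_pos (by omega) hq
  have hmj : (j : ℝ) ≤ ((m + 1 : ℕ) : ℝ) := by exact_mod_cast hjm.trans (Nat.le_succ m)
  have hjR : (⌈M₀⌉₊ : ℝ) + ⌈‖x‖ / δ⌉₊ + 1 ≤ j := by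
    exact_mod_cast (by omega : ⌈M₀⌉₊ + ⌈‖x‖ / δ⌉₊ + 1 ≤ j)
  have hM₀' : M₀ ≤ ((m + 1 : ℕ) : ℝ) := by
    have := Nat.le_ceil M₀
    have h0 : (0 : ℝ) ≤ ⌈‖x‖ / δ⌉₊ := Nat.cast_nonneg _
    linarith
  have hxδ : ‖x‖ / ((m + 1 : ℕ) : ℝ) < δ := by
    have := Nat.le_ceil (‖x‖ / δ)
    have h0 : (0 : ℝ) ≤ ⌈M₀⌉₊ := Nat.cast_nonneg _
    rw [div_lt_iff₀ (by positivity), mul_comm, ← div_lt_iff₀ hδ]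
    linarith
  -- The point at which the function scaled by (m + 1)^{1/2} has argument m^{1/2} x; both sides
  -- become values of one g, at x and at t.
  set t := sqrtN m / sqrtN (m + 1) * x with ht
  have hs : sqrtN (m + 1) ≠ 0 := sqrtN_ne_zero m.succ_ne_zero
  have hst : sqrtN (m + 1) * t = sqrtN m * x := by
    rw [ht, ← mul_assoc, mul_div_cancel₀ _ hs]
  have hxt : ‖x - t‖ ≤ ‖x‖ / ((m + 1 : ℕ) : ℝ) := sqrtN_div_estimate m x
  have htb : t ∈ Metric.ball x δ := by
    rw [Metric.mem_ball, dist_comm, dist_eq_norm]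
    exact hxt.trans_lt hxδ
  have hxb : x ∈ Metric.ball x δ := Metric.mem_ball_self hδ
  have hne' : ∀ s ∈ Metric.ball x δ,
      (hermiteDet (m + 1 : ℕ) n).eval (sqrtN (m + 1) * s) ≠ 0 ∧
      (hermiteDet (m + 1 : ℕ) (n + 1)).eval (sqrtN (m + 1) * s) ≠ 0 := fun s hs => by
    rw [← genHermite_eval_ne_zero_iff, ← genHermite_eval_ne_zero_iff]
    exact hne s hs
  obtain ⟨k, rfl⟩ : ∃ k, n = k + 1 := ⟨n - 1, by omega⟩
  -- The bound `e ≤ 6` amounts to 4n + 2 ≤ 6 (m + 1), which is where n ≤ m, that is q ≤ p, enters.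
  have h := hest ((m + 1 : ℕ) : ℝ) ((4 * (k + 1) + 2) / ((m + 1 : ℕ) : ℝ))
    (scaledSymm₂ (m + 1) (k + 1)) hM₀' (by positivity) (by
      rw [div_le_iff₀ (by positivity)]
      have : ((k + 1 : ℕ) : ℝ) ≤ m := by exact_mod_cast hnm
      push_cast at this ⊢
      linarith)
    (by
      rw [show 2 * (δ / 2) = δ by ring]
      exact fun s hs => (differentiableAt_scaledSymm₂ (hne' s hs).1
        (hne' s hs).2).differentiableWithinAt)
    (by
      rw [show 2 * (δ / 2) = δ by ring]
      exact fun s hs => isScaledPainleveIVAt_scaledSymm₂ m.succ_ne_zero (hne' s hs).1 (hne' s hs).2)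
    t hxt
  refine ⟨hst ▸ (hne t htb).1, hst ▸ (hne t htb).2,
    scaledSymm₂ (m + 1) (k + 1) x / scaledSymm₂ (m + 1) (k + 1) t - 1, h.2.trans ?_, ?_⟩
  · have : (0 : ℝ) < m := by exact_mod_cast (by omega : 0 < m)
    gcongr
    linarith
  · rw [← hst, wII_eq_scaledSymm₂ m.succ_ne_zero (hne' x hxb).1 (hne' x hxb).2,
      wII_eq_scaledSymm₂ m.succ_ne_zero (hne' t htb).1 (hne' t htb).2]
    have := h.1
    field_simp
    ring

end Rescaling

/-! ### Moments of the weight, and residues at infinity for boundary values. -/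

section ContourIntegrals

theorem circleMap_two_pi_sub (θ : ℝ) :
    circleMap 0 1 (2 * Real.pi - θ) = (circleMap 0 1 θ)⁻¹ := by
  simp only [circleMap_zero, Complex.ofReal_one, one_mul, ← Complex.exp_neg]
  push_cast
  rw [sub_mul, sub_eq_neg_add, Complex.exp_add, Complex.exp_two_pi_mul_I, mul_one]

theorem circleIntegral_comp_inv (g : ℂ → ℂ) :
    (∮ z in C(0, 1), g z) = ∮ z in C(0, 1), g z⁻¹ * (z ^ 2)⁻¹ := by
  simp only [circleIntegral, deriv_circleMap]
  have h := intervalIntegral.integral_comp_sub_left (a := 0) (b := 2 * Real.pi)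
    (fun θ => (circleMap 0 1 θ * Complex.I) • g (circleMap 0 1 θ)) (2 * Real.pi)
  rw [sub_self, sub_zero] at h
  rw [← h]
  refine intervalIntegral.integral_congr fun θ _ => ?_
  have hz : circleMap 0 1 θ ≠ 0 := circleMap_ne_center one_ne_zero
  simp only [circleMap_two_pi_sub, smul_eq_mul]
  field_simp

/-- The contour integrals which give the Taylor coefficients of `exp (2 y c z - c ^ 2 z ^ 2)`. -/
def taylorIntegral (y c : ℂ) (k : ℤ) : ℂ :=
  ∮ z in C(0, 1), z ^ (-k - 1) * Complex.exp (2 * y * c * z - c ^ 2 * z ^ 2)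

theorem taylorIntegral_of_neg (y c : ℂ) {k : ℤ} (hk : k < 0) : taylorIntegral y c k = 0 := by
  obtain ⟨j, hj⟩ : ∃ j : ℕ, -k - 1 = j := ⟨(-k - 1).toNat, by omega⟩
  simp only [taylorIntegral, hj, zpow_natCast]
  refine DiffContOnCl.circleIntegral_eq_zero zero_le_one (Differentiable.diffContOnCl ?_)
  fun_prop

theorem taylorIntegral_zero (y c : ℂ) : taylorIntegral y c 0 = 2 * Real.pi * Complex.I := by
  have hd : Differentiable ℂ fun z : ℂ => Complex.exp (2 * y * c * z - c ^ 2 * z ^ 2) := by fun_prop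
  have h := (hd.diffContOnCl (s := Metric.ball 0 1)).circleIntegral_sub_inv_smul
    (Metric.mem_ball_self one_pos)
  simpa [taylorIntegral] using h

theorem circleIntegrable_zpow_mul {f : ℂ → ℂ} (hf : ContinuousOn f (Metric.sphere 0 1)) (k : ℤ) :
    CircleIntegrable (fun z => z ^ k * f z) 0 1 := by
  refine ContinuousOn.circleIntegrable zero_le_one (ContinuousOn.mul ?_ hf)
  refine continuousOn_id.zpow₀ k fun z hz => Or.inl ?_
  rintro rfl
  simp at hz

/-- The derivative of z^{-k} exp (2ycz - c²z²) integrates to zero around the circle. -/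
theorem taylorIntegral_recurrence (y c : ℂ) (k : ℤ) :
    k * taylorIntegral y c k =
      2 * y * c * taylorIntegral y c (k - 1) - 2 * c ^ 2 * taylorIntegral y c (k - 2) := by
  set f : ℂ → ℂ := fun z => Complex.exp (2 * y * c * z - c ^ 2 * z ^ 2) with hf
  have hfc : ContinuousOn f (Metric.sphere 0 1) := by fun_prop
  have hd : ∀ z ∈ Metric.sphere (0 : ℂ) 1, HasDerivWithinAt (fun z => z ^ (-k) * f z)
      (2 * y * c * (z ^ (-(k - 1) - 1) * f z) - 2 * c ^ 2 * (z ^ (-(k - 2) - 1) * f z) -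
        k * (z ^ (-k - 1) * f z)) (Metric.sphere 0 1) z := by
    intro z hz
    have hz0 : z ≠ 0 := by rintro rfl; simp at hz
    have h1 := hasDerivAt_zpow (-k) z (Or.inl hz0)
    have h2 : HasDerivAt f (f z * (2 * y * c * 1 - c ^ 2 * (2 * z))) z := by
      refine HasDerivAt.cexp ?_
      refine ((hasDerivAt_id z).const_mul _).sub (HasDerivAt.const_mul _ ?_)
      simpa using hasDerivAt_pow 2 z
    refine ((h1.mul h2).congr_deriv ?_).hasDerivWithinAt
    rw [show -(k - 1) - 1 = -k by ring, show -(k - 2) - 1 = -k + 1 by ring, zpow_add_one₀ hz0]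
    push_cast
    ring
  have h := circleIntegral.integral_eq_zero_of_hasDerivWithinAt zero_le_one hd
  have i1 := circleIntegrable_zpow_mul hfc (-(k - 1) - 1)
  have i2 := circleIntegrable_zpow_mul hfc (-(k - 2) - 1)
  have i3 := circleIntegrable_zpow_mul hfc (-k - 1)
  have j1 : CircleIntegrable (fun z => 2 * y * c * (z ^ (-(k - 1) - 1) * f z)) 0 1 :=
    i1.const_fun_smul
  have j2 : CircleIntegrable (fun z => 2 * c ^ 2 * (z ^ (-(k - 2) - 1) * f z)) 0 1 :=
    i2.const_fun_smul
  have j3 : CircleIntegrable (fun z => k * (z ^ (-k - 1) * f z)) 0 1 := i3.const_fun_smul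
  have j12 : CircleIntegrable (fun z => 2 * y * c * (z ^ (-(k - 1) - 1) * f z) -
      2 * c ^ 2 * (z ^ (-(k - 2) - 1) * f z)) 0 1 := j1.sub j2
  rw [circleIntegral.integral_sub j12 j3, circleIntegral.integral_sub j1 j2,
    circleIntegral.integral_const_mul, circleIntegral.integral_const_mul,
    circleIntegral.integral_const_mul] at h
  unfold taylorIntegral
  linear_combination -h

theorem taylorIntegral_eq (y c : ℂ) (k : ℤ) :
    taylorIntegral y c k = 2 * Real.pi * Complex.I * c ^ k * (hermiteCoeffInt k).eval y := by
  rcases lt_or_ge k 0 with hk | hk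
  · rw [taylorIntegral_of_neg y c hk, hermiteCoeffInt_of_neg hk]
    simp
  lift k to ℕ using hk
  change taylorIntegral y c k = 2 * Real.pi * Complex.I * c ^ (k : ℤ) * (hermiteCoeff k).eval y
  rw [zpow_natCast]
  induction k using Nat.twoStepInduction with
  | zero => simpa [hermiteCoeff] using taylorIntegral_zero y c
  | one =>
    have h := taylorIntegral_recurrence y c 1
    rw [taylorIntegral_of_neg y c (by norm_num : (1 : ℤ) - 2 < 0), sub_self,
      taylorIntegral_zero] at h
    simp [hermiteCoeff] at h ⊢
    linear_combination h
  | more k ih0 ih1 =>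
    have h := taylorIntegral_recurrence y c (k + 2 : ℕ)
    rw [show ((k + 2 : ℕ) : ℤ) - 1 = (k + 1 : ℕ) by push_cast; ring,
      show ((k + 2 : ℕ) : ℤ) - 2 = k by push_cast; ring, ih0, ih1] at h
    have h' := congrArg (eval y) (hermiteCoeff_recurrence k)
    simp only [eval_mul, eval_add, eval_sub, eval_natCast, eval_ofNat, eval_X] at h'
    have hk : ((k : ℂ) + 2) ≠ 0 := by exact_mod_cast (by omega : k + 2 ≠ 0)
    apply mul_left_cancel₀ hk
    push_cast at h ⊢
    linear_combination h - 2 * Real.pi * Complex.I * c ^ (k + 2) * h'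

/-- The substitution z ↦ 1/z turns the essential singularity at 0 into an entire exponential. -/
theorem circleIntegral_zpow_mul_exp (y c : ℂ) (k : ℤ) :
    (∮ z in C(0, 1), z ^ (k - 1) * Complex.exp (2 * y * c / z - c ^ 2 / z ^ 2)) =
      2 * Real.pi * Complex.I * c ^ k * (hermiteCoeffInt k).eval y := by
  rw [circleIntegral_comp_inv, ← taylorIntegral_eq, taylorIntegral]
  refine circleIntegral.integral_congr zero_le_one fun z hz => ?_
  have hz0 : z ≠ 0 := by rintro rfl; simp at hz
  rw [show -k - 1 = -(k - 1) + (-2 : ℤ) by ring, zpow_add₀ hz0, inv_zpow', inv_pow, div_inv_eq_mul,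
    div_inv_eq_mul, zpow_neg z 2, mul_right_comm]
  rfl

/-- The function `F`, with the boundary values `Fb` on the unit circle. -/
def withBoundary (F Fb : ℂ → ℂ) (z : ℂ) : ℂ := by
  classical exact if ‖z‖ = 1 then Fb z else F z

theorem withBoundary_of_norm_eq {F Fb : ℂ → ℂ} {z : ℂ} (hz : ‖z‖ = 1) :
    withBoundary F Fb z = Fb z := by simp [withBoundary, hz]

theorem withBoundary_of_norm_ne {F Fb : ℂ → ℂ} {z : ℂ} (hz : ‖z‖ ≠ 1) :
    withBoundary F Fb z = F z := by simp [withBoundary, hz]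

theorem continuousOn_withBoundary {F Fb : ℂ → ℂ} {S : Set ℂ} (hS : IsOpen S)
    (hS1 : ∀ z ∈ S, ‖z‖ ≠ 1) (hF : ContinuousOn F S)
    (hb : ∀ ζ ∈ Metric.sphere (0 : ℂ) 1, Tendsto F (𝓝[S] ζ) (𝓝 (Fb ζ)))
    (hc : ContinuousOn Fb (Metric.sphere 0 1)) :
    ContinuousOn (withBoundary F Fb) (S ∪ Metric.sphere 0 1) := by
  rintro z (hz | hz)
  · refine ContinuousAt.continuousWithinAt ?_
    refine (hF.continuousAt (hS.mem_nhds hz)).congr ?_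
    filter_upwards [hS.mem_nhds hz] with t ht
    exact (withBoundary_of_norm_ne (hS1 t ht)).symm
  · have hz1 : ‖z‖ = 1 := by simpa using hz
    rw [ContinuousWithinAt, nhdsWithin_union, withBoundary_of_norm_eq hz1]
    refine Tendsto.sup ?_ ?_
    · refine (hb z hz).congr' ?_
      filter_upwards [self_mem_nhdsWithin] with t ht
      exact (withBoundary_of_norm_ne (hS1 t ht)).symm
    · refine Tendsto.congr' ?_ (hc z hz)
      filter_upwards [self_mem_nhdsWithin] with t ht
      exact (withBoundary_of_norm_eq (by simpa using ht)).symm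

theorem differentiableOn_withBoundary {F Fb : ℂ → ℂ} {S : Set ℂ}
    (hS1 : ∀ z ∈ S, ‖z‖ ≠ 1) (hF : DifferentiableOn ℂ F S) :
    DifferentiableOn ℂ (withBoundary F Fb) S :=
  hF.congr fun z hz => withBoundary_of_norm_ne (hS1 z hz)

theorem isOpen_exterior : IsOpen {z : ℂ | 1 < ‖z‖} := isOpen_lt continuous_const continuous_norm

/-- The integral over the unit circle of the boundary values of a function which is holomorphic in
the exterior is given by its residue at infinity. -/
theorem circleIntegral_of_isBigO {F Fb : ℂ → ℂ} {a : ℂ}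
    (hF : DifferentiableOn ℂ F {z : ℂ | 1 < ‖z‖})
    (hb : ∀ ζ ∈ Metric.sphere (0 : ℂ) 1, Tendsto F (𝓝[{z : ℂ | 1 < ‖z‖}] ζ) (𝓝 (Fb ζ)))
    (hc : ContinuousOn Fb (Metric.sphere 0 1))
    (hO : (fun z => F z - a * z⁻¹) =O[Bornology.cobounded ℂ] fun z : ℂ => (z ^ 2)⁻¹) :
    (∮ z in C(0, 1), Fb z) = 2 * Real.pi * Complex.I * a := by
  have hS1 : ∀ z ∈ {z : ℂ | 1 < ‖z‖}, ‖z‖ ≠ 1 := fun z hz => ne_of_gt hz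
  have hcont := continuousOn_withBoundary isOpen_exterior hS1 hF.continuousOn hb hc
  have hdiff := differentiableOn_withBoundary (Fb := Fb) hS1 hF
  -- Contour deformation in the annulus, where continuity up to the unit circle suffices.
  have hR : ∀ R : ℝ, 1 < R → (∮ z in C(0, 1), Fb z) = ∮ z in C(0, R), F z := by
    intro R hR
    have h := Complex.circleIntegral_eq_of_differentiable_on_annulus_off_countable
      (c := 0) (f := withBoundary F Fb) one_pos hR.le Set.countable_empty
      (hcont.mono fun z hz => ?_) (fun z hz => ?_)
    · rw [circleIntegral.integral_congr (g := F) (by linarith) fun z hz => ?_,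
        circleIntegral.integral_congr (g := Fb) zero_le_one fun z hz => ?_] at h
      · exact h.symm
      · exact withBoundary_of_norm_eq (by simpa using hz)
      · refine withBoundary_of_norm_ne ?_
        have : ‖z‖ = R := by simpa using hz
        linarith
    · have : 1 ≤ ‖z‖ := by simpa using hz.2
      rcases this.eq_or_lt with h | h
      · exact Or.inr (by simp [← h])
      · exact Or.inl h
    · have : 1 < ‖z‖ := by simpa using hz.1.2
      exact (hdiff z this).differentiableAt (isOpen_exterior.mem_nhds this)
  obtain ⟨K, hK⟩ := hO.bound
  obtain ⟨R₀, hR₀⟩ : ∃ R₀ : ℝ, ∀ z : ℂ, R₀ ≤ ‖z‖ → ‖F z - a * z⁻¹‖ ≤ K * ‖(z ^ 2)⁻¹‖ := by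
    rw [← comap_norm_atTop, eventually_comap, eventually_atTop] at hK
    obtain ⟨R₀, h⟩ := hK
    exact ⟨R₀, fun z hz => h _ hz z rfl⟩
  -- On the circle of radius R the integrand differs from a / z by at most K / R², which over length
  -- 2πR leaves O(1/R).
  have hest : ∀ R : ℝ, max R₀ 2 ≤ R →
      ‖(∮ z in C(0, 1), Fb z) - 2 * Real.pi * Complex.I * a‖ ≤ 2 * Real.pi * K * R⁻¹ := by
    intro R hR'
    have hR2 : 2 ≤ R := (le_max_right _ _).trans hR'
    have hR0 : 0 < R := by linarith
    have hFi : CircleIntegrable F 0 R := by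
      refine ContinuousOn.circleIntegrable hR0.le (hF.continuousOn.mono fun z hz => ?_)
      have : ‖z‖ = R := by simpa using hz
      change 1 < ‖z‖
      linarith
    have hai : CircleIntegrable (fun z : ℂ => a * z⁻¹) 0 R := by
      refine ContinuousOn.circleIntegrable hR0.le (continuousOn_const.mul
        (continuousOn_id.inv₀ fun z hz => ?_))
      rintro rfl
      have : (0 : ℝ) = R := by simpa using hz
      linarith
    have hav : (∮ z in C(0, R), a * z⁻¹) = 2 * Real.pi * Complex.I * a := by
      have h := circleIntegral.integral_sub_center_inv (0 : ℂ) hR0.ne'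
      simp only [sub_zero] at h
      rw [circleIntegral.integral_const_mul, h]
      ring
    rw [hR R (by linarith), ← hav, ← circleIntegral.integral_sub hFi hai]
    refine (circleIntegral.norm_integral_le_of_norm_le_const (C := K * (R ^ 2)⁻¹) hR0.le
      fun z hz => ?_).trans_eq ?_
    · have hz' : ‖z‖ = R := by simpa using hz
      have := hR₀ z (by rw [hz']; exact (le_max_left _ _).trans hR')
      rwa [norm_inv, norm_pow, hz'] at this
    · field_simp
  have hlim : Tendsto (fun R : ℝ => 2 * Real.pi * K * R⁻¹) atTop (𝓝 0) := by
    simpa using tendsto_inv_atTop_zero.const_mul (2 * Real.pi * K)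
  have := ge_of_tendsto hlim (eventually_atTop.2 ⟨_, hest⟩)
  exact sub_eq_zero.1 (norm_le_zero_iff.1 this)

theorem diffContOnCl_withBoundary {F Fb : ℂ → ℂ}
    (hF : DifferentiableOn ℂ F {z : ℂ | ‖z‖ < 1})
    (hb : ∀ ζ ∈ Metric.sphere (0 : ℂ) 1, Tendsto F (𝓝[{z : ℂ | ‖z‖ < 1}] ζ) (𝓝 (Fb ζ)))
    (hc : ContinuousOn Fb (Metric.sphere 0 1)) :
    DiffContOnCl ℂ (withBoundary F Fb) (Metric.ball 0 1) := by
  have hball : {z : ℂ | ‖z‖ < 1} = Metric.ball 0 1 := by ext z; simp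
  have hS1 : ∀ z ∈ {z : ℂ | ‖z‖ < 1}, ‖z‖ ≠ 1 := fun z hz => ne_of_lt hz
  have hcont := continuousOn_withBoundary (isOpen_lt continuous_norm continuous_const)
    hS1 hF.continuousOn hb hc
  rw [hball, Metric.ball_union_sphere] at hcont
  refine ⟨?_, ?_⟩
  · rw [← hball]
    exact differentiableOn_withBoundary hS1 hF
  · rwa [closure_ball _ one_ne_zero]

theorem zpow_isBigO_zpow {a b : ℤ} (hab : a ≤ b) :
    (fun z : ℂ => z ^ a) =O[Bornology.cobounded ℂ] fun z => z ^ b := by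
  refine IsBigO.of_bound 1 ?_
  filter_upwards [(tendsto_norm_cobounded_atTop (E := ℂ)).eventually_ge_atTop 1] with z hz
  rw [norm_zpow, norm_zpow, one_mul]
  exact zpow_le_zpow_right₀ hz hab

end ContourIntegrals

/-! ### The first row of a solution: orthogonal polynomial and moments. -/

section RiemannHilbert

theorem tendsto_zpow_mul_boundary {F : ℂ → ℂ} {S : Set ℂ} {ζ b : ℂ} (hζ : ζ ∈ Metric.sphere (0 : ℂ) 1)
    (h : Tendsto F (𝓝[S] ζ) (𝓝 b)) (k : ℤ) :
    Tendsto (fun z => z ^ k * F z) (𝓝[S] ζ) (𝓝 (ζ ^ k * b)) := by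
  have h0 : ζ ≠ 0 := by rintro rfl; simp at hζ
  exact ((continuousAt_zpow₀ ζ k (Or.inl h0)).tendsto.mono_left nhdsWithin_le_nhds).mul h

/-- A weighted version of `circleIntegral_of_isBigO`. -/
theorem circleIntegral_zpow_mul_of_isBigO {F Fb : ℂ → ℂ} {a : ℂ} (k : ℤ)
    (hF : DifferentiableOn ℂ F {z : ℂ | 1 < ‖z‖})
    (hb : ∀ ζ ∈ Metric.sphere (0 : ℂ) 1, Tendsto F (𝓝[{z : ℂ | 1 < ‖z‖}] ζ) (𝓝 (Fb ζ)))
    (hc : ContinuousOn Fb (Metric.sphere 0 1))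
    (hO : (fun z => z ^ k * F z - a * z⁻¹) =O[Bornology.cobounded ℂ] fun z : ℂ => (z ^ 2)⁻¹) :
    (∮ z in C(0, 1), z ^ k * Fb z) = 2 * Real.pi * Complex.I * a := by
  refine circleIntegral_of_isBigO (F := fun z => z ^ k * F z) ?_
    (fun ζ hζ => tendsto_zpow_mul_boundary hζ (hb ζ hζ) k) ?_ hO
  · intro z hz
    have hz0 : z ≠ 0 := by
      rintro rfl
      have : (1 : ℝ) < ‖(0 : ℂ)‖ := hz
      norm_num at this
    exact (differentiableAt_zpow.2 (Or.inl hz0)).differentiableWithinAt.mul (hF z hz)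
  · refine ContinuousOn.mul (continuousOn_id.zpow₀ k fun z hz => Or.inl ?_) hc
    rintro rfl
    simp at hz

/-- A function which is holomorphic off the unit circle, with equal boundary values from both sides,
and which is `z ^ n (1 + O (1 / z))` at infinity, is a monic polynomial of degree `n`
in the disc. -/
theorem exists_monic_polynomial {F Fb : ℂ → ℂ} {n : ℕ}
    (hFe : DifferentiableOn ℂ F {z : ℂ | 1 < ‖z‖}) (hFi : DifferentiableOn ℂ F {z : ℂ | ‖z‖ < 1})
    (hbe : ∀ ζ ∈ Metric.sphere (0 : ℂ) 1, Tendsto F (𝓝[{z : ℂ | 1 < ‖z‖}] ζ) (𝓝 (Fb ζ)))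
    (hbi : ∀ ζ ∈ Metric.sphere (0 : ℂ) 1, Tendsto F (𝓝[{z : ℂ | ‖z‖ < 1}] ζ) (𝓝 (Fb ζ)))
    (hc : ContinuousOn Fb (Metric.sphere 0 1))
    (hO : (fun z => F z * (z ^ n)⁻¹ - 1) =O[Bornology.cobounded ℂ] fun z : ℂ => z⁻¹) :
    ∃ a : ℕ → ℂ, a n = 1 ∧ a 0 = F 0 ∧
      ∀ ζ ∈ Metric.sphere (0 : ℂ) 1, Fb ζ = ∑ i ∈ Finset.range (n + 1), a i * ζ ^ i := by
  have hne : ∀ᶠ z : ℂ in Bornology.cobounded ℂ, z ≠ 0 := by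
    filter_upwards [(tendsto_norm_cobounded_atTop (E := ℂ)).eventually_ge_atTop 1] with z hz
    rintro rfl
    norm_num at hz
  -- Taylor coefficients in the disc, as integrals of the common boundary values. Evaluated from
  -- outside by the residue at infinity, they are 1 for k = n and 0 for k > n.
  set a : ℕ → ℂ := fun k => (2 * Real.pi * Complex.I)⁻¹ *
    ∮ z in C(0, 1), z ^ (-(k : ℤ) - 1) * Fb z with ha
  have hpi : (2 * Real.pi * Complex.I : ℂ) ≠ 0 := Complex.two_pi_I_ne_zero
  have hO1 : (fun z => F z * (z ^ n)⁻¹) =O[Bornology.cobounded ℂ] fun _ : ℂ => (1 : ℂ) := by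
    have h1 : (fun z : ℂ => z⁻¹) =O[Bornology.cobounded ℂ] fun _ : ℂ => (1 : ℂ) := by
      have := zpow_isBigO_zpow (a := -1) (b := 0) (by norm_num)
      simpa using this
    have := (hO.trans h1).add (isBigO_refl (fun _ : ℂ => (1 : ℂ)) _)
    simpa using this
  have ha_n : a n = 1 := by
    have := circleIntegral_zpow_mul_of_isBigO (a := 1) (-(n : ℤ) - 1) hFe hbe hc (by
      refine IsBigO.congr' ((isBigO_refl (fun z : ℂ => z⁻¹) _).mul hO) ?_ ?_
      · filter_upwards [hne] with z hz
        rw [zpow_sub_one₀ hz, zpow_neg, zpow_natCast]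
        ring
      · filter_upwards with z
        rw [← mul_inv, pow_two])
    rw [ha]
    simp only [this, mul_one]
    exact inv_mul_cancel₀ hpi
  have ha_gt : ∀ k, n < k → a k = 0 := by
    intro k hk
    have := circleIntegral_zpow_mul_of_isBigO (a := 0) (-(k : ℤ) - 1) hFe hbe hc (by
      refine IsBigO.congr' ((zpow_isBigO_zpow (a := (n : ℤ) - k - 1) (b := -2)
        (by omega)).mul hO1) ?_ ?_
      · filter_upwards [hne] with z hz
        rw [show (n : ℤ) - k - 1 = n + (-(k : ℤ) - 1) by ring, zpow_add₀ hz, zpow_natCast]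
        field_simp
        ring
      · filter_upwards with z
        rw [mul_one, zpow_neg]
        rfl)
    rw [ha]
    simp only [this, mul_zero]
  have hD := diffContOnCl_withBoundary hFi hbi hc
  have hps := DiffContOnCl.hasFPowerSeriesOnBall (R := 1) (c := 0) (f := withBoundary F Fb)
    (by simpa using hD) one_pos
  have hsum : ∀ z ∈ Metric.ball (0 : ℂ) 1,
      withBoundary F Fb z = ∑ i ∈ Finset.range (n + 1), a i * z ^ i := by
    intro z hz
    have h := hps.hasSum (y := z) (by
      rw [Metric.eball_coe]
      simpa using hz)
    rw [zero_add] at h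
    have hterm : ∀ k, (cauchyPowerSeries (withBoundary F Fb) 0 ((1 : ℝ≥0) : ℝ) k fun _ => z) =
        a k * z ^ k := by
      intro k
      rw [cauchyPowerSeries_apply, ha]
      simp only [NNReal.coe_one, sub_zero, smul_eq_mul]
      rw [mul_assoc _ _ (z ^ k), mul_comm (∮ z in C(0, 1), _) (z ^ k),
        ← circleIntegral.integral_const_mul (z ^ k)]
      refine congrArg _ (circleIntegral.integral_congr zero_le_one fun w hw => ?_)
      have hw0 : w ≠ 0 := by rintro rfl; simp at hw
      rw [withBoundary_of_norm_eq (by simpa using hw), zpow_sub_one₀ hw0, zpow_neg, zpow_natCast,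
        div_pow]
      ring
    simp only [hterm] at h
    refine h.unique (hasSum_sum_of_ne_finset_zero fun k hk => ?_)
    rw [ha_gt k (by simpa using hk), zero_mul]
  refine ⟨a, ha_n, ?_, ?_⟩
  · have h := hsum 0 (by simp)
    rw [withBoundary_of_norm_ne (by simp), Finset.sum_range_succ', Finset.sum_eq_zero] at h
    · simpa using h.symm
    · intro i _
      simp
  · intro ζ hζ
    have hpoly : ContinuousOn (fun z : ℂ => ∑ i ∈ Finset.range (n + 1), a i * z ^ i)
        (Metric.closedBall 0 1) := by fun_prop
    have hcl : ContinuousOn (withBoundary F Fb) (Metric.closedBall 0 1) := by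
      rw [← closure_ball (0 : ℂ) one_ne_zero]
      exact hD.continuousOn
    have h := Set.EqOn.of_subset_closure (s := Metric.ball (0 : ℂ) 1) hsum hcl hpoly
      Metric.ball_subset_closedBall (by rw [closure_ball (0 : ℂ) one_ne_zero])
      (Metric.sphere_subset_closedBall hζ)
    rwa [withBoundary_of_norm_eq (by simpa using hζ)] at h

/-- The first row of a solution: a monic polynomial of degree `n` which is orthogonal to the powers
`1, z, …, z ^ (n - 1)` with respect to the weight in the jump. -/
theorem IsRHPSolution.exists_orthogonal_polynomial {m n : ℕ} {x : ℂ}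
    {N : ℂ → Matrix (Fin 2) (Fin 2) ℂ} {N₀ N₁ Nminus : Matrix (Fin 2) (Fin 2) ℂ}
    (hN : IsRHPSolution m n x N) (h0 : ExpandsAtZero N N₀ N₁)
    (hinf : ExpandsAtInfinity n N Nminus) :
    ∃ a : ℕ → ℂ, a n = 1 ∧ a 0 = N₀ 0 0 ∧ ∃ P : ℂ → ℂ,
      (∀ z, P z = (∑ i ∈ Finset.range (n + 1), a i * z ^ i) * jumpMatrix m n x z 0 1) ∧
      (∀ l < n, (∮ z in C(0, 1), z ^ (l : ℤ) * P z) = 0) ∧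
      (∮ z in C(0, 1), z ^ (-1 : ℤ) * P z) = -(2 * Real.pi * Complex.I * N₀ 0 1) ∧
      (∮ z in C(0, 1), z ^ (n : ℤ) * P z) = 2 * Real.pi * Complex.I * Nminus 0 1 := by
  obtain ⟨Np, Nm, ⟨K, α, hα, hH⟩, hlim, hjump⟩ := hN.jump
  have hcp : ∀ i j, ContinuousOn (fun z => Np z i j) (Metric.sphere 0 1) := fun i j =>
    (hH i j).1.continuousOn hα
  have hcm : ∀ i j, ContinuousOn (fun z => Nm z i j) (Metric.sphere 0 1) := fun i j =>
    (hH i j).2.continuousOn hα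
  have he : ∀ i j, DifferentiableOn ℂ (fun z => N z i j) {z : ℂ | 1 < ‖z‖} := fun i j =>
    (hN.analytic i j).mono fun z hz => by
      have : 1 < ‖z‖ := hz
      simp only [Set.mem_compl_iff, mem_sphere_zero_iff_norm]
      linarith
  have hi : ∀ i j, DifferentiableOn ℂ (fun z => N z i j) {z : ℂ | ‖z‖ < 1} := fun i j =>
    (hN.analytic i j).mono fun z hz => by
      have : ‖z‖ < 1 := hz
      simp only [Set.mem_compl_iff, mem_sphere_zero_iff_norm]
      linarith
  -- The neighbourhood filter at 0 contains the point itself, so the O(z²) bound forces equality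
  -- there.
  have hN0 : ∀ i j, N 0 i j = N₀ i j := by
    intro i j
    have := (h0 i j).eq_zero_imp.self_of_nhds
    simp only [Matrix.sub_apply, zero_smul, Matrix.zero_apply, sub_zero] at this
    exact sub_eq_zero.1 (this (by norm_num))
  have hj0 : ∀ ζ ∈ Metric.sphere (0 : ℂ) 1, Np ζ 0 0 = Nm ζ 0 0 := by
    intro ζ hζ
    rw [hjump ζ hζ]
    simp [jumpMatrix, Matrix.mul_apply, Fin.sum_univ_two]
  have hj1 : ∀ ζ ∈ Metric.sphere (0 : ℂ) 1,
      Np ζ 0 1 = Nm ζ 0 0 * jumpMatrix m n x ζ 0 1 + Nm ζ 0 1 := by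
    intro ζ hζ
    rw [hjump ζ hζ]
    simp [jumpMatrix, Matrix.mul_apply, Fin.sum_univ_two]
  obtain ⟨a, ha1, ha0, ha⟩ := exists_monic_polynomial (n := n) (he 0 0) (hi 0 0)
    (fun ζ hζ => hj0 ζ hζ ▸ (hlim ζ hζ 0 0).1) (fun ζ hζ => (hlim ζ hζ 0 0).2) (hcm 0 0) (by
      have := hN.normalized 0 0
      simpa [zPowNegSigma, Matrix.mul_apply, Fin.sum_univ_two] using this)
  have hne : ∀ᶠ z : ℂ in Bornology.cobounded ℂ, z ≠ 0 := by
    filter_upwards [(tendsto_norm_cobounded_atTop (E := ℂ)).eventually_ge_atTop 1] with z hz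
    rintro rfl
    norm_num at hz
  set P : ℂ → ℂ := fun z =>
    (∑ i ∈ Finset.range (n + 1), a i * z ^ i) * jumpMatrix m n x z 0 1 with hP
  -- P is the jump of the (1,2) entry, so its moments split into an exterior part, given by
  -- behaviour at infinity, and an interior part, given by Cauchy's theorem or formula.
  have hPint : ∀ k : ℤ, (∮ z in C(0, 1), z ^ k * P z) =
      (∮ z in C(0, 1), z ^ k * Np z 0 1) - ∮ z in C(0, 1), z ^ k * Nm z 0 1 := by
    intro k
    rw [← circleIntegral.integral_sub (circleIntegrable_zpow_mul (hcp 0 1) k)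
      (circleIntegrable_zpow_mul (hcm 0 1) k)]
    refine circleIntegral.integral_congr zero_le_one fun z hz => ?_
    simp only [hP]
    rw [hj1 z hz, ha z hz]
    ring
  have hO : (fun z => N z 0 1 * z ^ n) =O[Bornology.cobounded ℂ] fun z : ℂ => z⁻¹ := by
    have := hN.normalized 0 1
    simpa [zPowNegSigma, Matrix.mul_apply, Fin.sum_univ_two] using this
  -- Outside, z^k N₁₂ = O(z^{k-n-1}): there is no residue at infinity for k < n, and k = n picks out
  -- the coefficient `Nminus 0 1`.
  have hOut : ∀ k : ℤ, k < n → (∮ z in C(0, 1), z ^ k * Np z 0 1) = 0 := by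
    intro k hk
    have := circleIntegral_zpow_mul_of_isBigO (a := 0) k (he 0 1)
      (fun ζ hζ => (hlim ζ hζ 0 1).1) (hcp 0 1) (by
        refine IsBigO.congr' ((zpow_isBigO_zpow (a := k - n) (b := -1) (by omega)).mul hO) ?_ ?_
        · filter_upwards [hne] with z hz
          rw [zpow_sub₀ hz, zpow_natCast]
          field_simp
          ring
        · filter_upwards with z
          rw [zpow_neg_one, ← mul_inv, pow_two])
    rw [this, mul_zero]
  have hOut_n : (∮ z in C(0, 1), z ^ (n : ℤ) * Np z 0 1) =
      2 * Real.pi * Complex.I * Nminus 0 1 := by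
    refine circleIntegral_zpow_mul_of_isBigO (a := Nminus 0 1) n (he 0 1)
      (fun ζ hζ => (hlim ζ hζ 0 1).1) (hcp 0 1) ?_
    have := hinf 0 1
    simp only [zPowNegSigma, Matrix.sub_apply, Matrix.mul_apply, Fin.sum_univ_two,
      Matrix.smul_apply, smul_eq_mul] at this
    simpa [mul_comm] using this
  have hD : DiffContOnCl ℂ (withBoundary (fun z => N z 0 1) fun z => Nm z 0 1)
      (Metric.ball 0 1) :=
    diffContOnCl_withBoundary (hi 0 1) (fun ζ hζ => (hlim ζ hζ 0 1).2) (hcm 0 1)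
  have hIn : ∀ k : ℕ, (∮ z in C(0, 1), z ^ (k : ℤ) * Nm z 0 1) = 0 := by
    intro k
    have h := DiffContOnCl.circleIntegral_eq_zero zero_le_one
      ((differentiable_pow (𝕜 := ℂ) (𝔸 := ℂ) k).diffContOnCl.smul hD)
    refine Eq.trans ?_ h
    refine circleIntegral.integral_congr zero_le_one fun z hz => ?_
    simp only [smul_eq_mul, zpow_natCast]
    rw [← withBoundary_of_norm_eq (F := fun z => N z 0 1) (Fb := fun z => Nm z 0 1)
      (by simpa using hz)]
  have hIn_neg : (∮ z in C(0, 1), z ^ (-1 : ℤ) * Nm z 0 1) =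
      2 * Real.pi * Complex.I * N₀ 0 1 := by
    have h := hD.circleIntegral_sub_inv_smul (Metric.mem_ball_self one_pos)
    rw [withBoundary_of_norm_ne (by simp)] at h
    simp only [hN0, smul_eq_mul] at h
    rw [← h]
    refine circleIntegral.integral_congr zero_le_one fun z hz => ?_
    simp only [sub_zero, zpow_neg_one]
    rw [withBoundary_of_norm_eq (by simpa using hz)]
  refine ⟨a, ha1, by rw [ha0, hN0], P, fun z => rfl, ?_, ?_, ?_⟩
  · intro l hl
    rw [hPint, hOut l (by omega), hIn, sub_zero]
  · rw [hPint, hOut (-1) (by omega), hIn_neg, zero_sub]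
  · rw [hPint, hOut_n, hIn, sub_zero]

end RiemannHilbert

/-! ### Entries of the solution as ratios of determinants, and the conclusion. -/

section ExactFormula

theorem jumpMatrix_zero_one {m n : ℕ} (hn : n ≠ 0) (x : ℂ) {z : ℂ} (hz : z ≠ 0) :
    jumpMatrix m n x z 0 1 = (2 * Real.pi * Complex.I)⁻¹ * (z ^ ((m : ℤ) - n) *
      Complex.exp (2 * (sqrtN m * x) * sqrtN n / z - sqrtN n ^ 2 / z ^ 2)) := by
  have hnC : (n : ℂ) ≠ 0 := by exact_mod_cast hn
  have hc := sqrtN_ne_zero hn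
  have hr : ((Real.sqrt ((m : ℝ) / (n : ℝ)) : ℝ) : ℂ) = sqrtN m / sqrtN n := by
    rw [Real.sqrt_div (Nat.cast_nonneg m)]
    simp [sqrtN]
  have hexp : -(n : ℂ) * theta ((m : ℝ) / (n : ℝ)) x z = (((m : ℤ) - n : ℤ) : ℂ) * Complex.log z +
      (2 * (sqrtN m * x) * sqrtN n / z - sqrtN n ^ 2 / z ^ 2) := by
    unfold theta
    rw [hr, ← sqrtN_sq n] at *
    push_cast
    rw [← sqrtN_sq n]
    field_simp
    ring
  simp only [jumpMatrix, Matrix.of_apply, Matrix.cons_val_zero, Matrix.cons_val_one,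
    Matrix.cons_val_fin_one, Matrix.cons_val', hexp]
  rw [Complex.exp_add, Complex.exp_int_mul, Complex.exp_log hz, one_div]

theorem circleIntegral_weighted_polynomial {m n : ℕ} (hn : n ≠ 0) (x : ℂ) (a : ℕ → ℂ) (k : ℤ) :
    (∮ z in C(0, 1), z ^ k * ((∑ i ∈ Finset.range (n + 1), a i * z ^ i) *
      jumpMatrix m n x z 0 1)) =
    sqrtN n ^ (k + m - n + 1) * ∑ i ∈ Finset.range (n + 1), a i * sqrtN n ^ i *
      (hermiteCoeffInt (k + m - n + 1 + i)).eval (sqrtN m * x) := by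
  have hc := sqrtN_ne_zero hn
  set y := sqrtN m * x with hy
  set c := sqrtN n with hcdef
  set E : ℂ → ℂ := fun z => Complex.exp (2 * y * c / z - c ^ 2 / z ^ 2) with hE
  have hEc : ContinuousOn E (Metric.sphere 0 1) := by
    have h0 : ∀ z ∈ Metric.sphere (0 : ℂ) 1, z ≠ 0 := by
      rintro z hz rfl
      simp at hz
    refine Complex.continuous_exp.comp_continuousOn ?_
    refine ContinuousOn.sub (continuousOn_const.div continuousOn_id h0)
      (continuousOn_const.div (continuousOn_id.pow 2) fun z hz => pow_ne_zero 2 (h0 z hz))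
  have hpi : (2 * Real.pi * Complex.I : ℂ) ≠ 0 := Complex.two_pi_I_ne_zero
  have h1 : (∮ z in C(0, 1), z ^ k * ((∑ i ∈ Finset.range (n + 1), a i * z ^ i) *
      jumpMatrix m n x z 0 1)) = ∮ z in C(0, 1), ∑ i ∈ Finset.range (n + 1),
        (a i * (2 * Real.pi * Complex.I)⁻¹) * (z ^ ((k + m - n + 1 + i) - 1) * E z) := by
    refine circleIntegral.integral_congr zero_le_one fun z hz => ?_
    have hz0 : z ≠ 0 := by rintro rfl; simp at hz
    rw [jumpMatrix_zero_one hn x hz0, Finset.sum_mul, Finset.mul_sum]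
    refine Finset.sum_congr rfl fun i _ => ?_
    rw [show (k + m - n + 1 + i) - 1 = k + (i + ((m : ℤ) - n)) by ring, zpow_add₀ hz0,
      zpow_add₀ hz0, zpow_natCast]
    ring
  rw [h1, circleIntegral.integral_fun_sum, Finset.mul_sum]
  · refine Finset.sum_congr rfl fun i _ => ?_
    rw [circleIntegral.integral_const_mul, circleIntegral_zpow_mul_exp, zpow_add₀ hc,
      zpow_natCast]
    field_simp
  · intro i _
    exact (circleIntegrable_zpow_mul hEc _).const_fun_smul

/-- Orthogonality says M v = (u · v) e₀; apply the adjugate, whose (j, 0) entry is the determinant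
with row 0 replaced by e_j. -/
theorem det_mul_eq_of_orthogonal {R : Type*} [CommRing R] {n : ℕ} (c : Fin n → Fin (n + 1) → R)
    (u v : Fin (n + 1) → R) (h : ∀ i, c i ⬝ᵥ v = 0) (j : Fin (n + 1)) :
    rowDet (Fin.cons u c : Fin (n + 1) → Fin (n + 1) → R) * v j =
      (u ⬝ᵥ v) * rowDet (Fin.cons (Pi.single j 1) c : Fin (n + 1) → Fin (n + 1) → R) := by
  set M : Matrix (Fin (n + 1)) (Fin (n + 1)) R := Matrix.of (Fin.cons u c) with hM
  have h1 : M.mulVec v = Pi.single 0 (u ⬝ᵥ v) := by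
    ext i
    refine Fin.cases ?_ (fun i => ?_) i
    · simp [hM, Matrix.mulVec]
    · have := h i
      simp [hM, Matrix.mulVec, this]
  have h2 := congrArg (fun w => M.adjugate.mulVec w j) h1
  simp only [Matrix.mulVec_mulVec, Matrix.adjugate_mul, Matrix.smul_mulVec, Matrix.one_mulVec,
    Pi.smul_apply, smul_eq_mul, Matrix.mulVec_single, Matrix.col_apply, op_smul_eq_mul,
    Matrix.adjugate_apply] at h2
  have h3 := Fin.update_cons_zero (α := fun _ => Fin (n + 1) → R) u c (Pi.single j 1)
  have h4 : M.updateRow 0 (Pi.single j 1) = Matrix.of (Fin.cons (Pi.single j 1) c) := by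
    rw [← h3]
    rfl
  rw [h4, mul_comm] at h2
  unfold rowDet
  rw [mul_comm, h2, mul_comm]

theorem toepDet_eval (y : ℂ) (m : ℤ) (n : ℕ) :
    toepDet (fun k => (hermiteCoeffInt k).eval y) m n = (hermiteDet m n).eval y := by
  unfold hermiteDet toepDet rowDet
  rw [← coe_evalRingHom, RingHom.map_det]
  rfl

/-- Cramer's rule for a vector orthogonal to the rows of a Toeplitz determinant. -/
theorem toepDet_relations {R : Type*} [CommRing R] (h : ℤ → R) (m : ℤ) (n : ℕ)
    (v : Fin (n + 1) → R) (hv : ∀ i : Fin n, shiftRow h (m - (i : ℕ)) (n + 1) ⬝ᵥ v = 0) :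
    toepDet h (m + 1) (n + 1) * v (Fin.last n) =
      (shiftRow h (m + 1) (n + 1) ⬝ᵥ v) * ((-1) ^ n * toepDet h m n) ∧
    toepDet h m (n + 1) * v (Fin.last n) =
      (shiftRow h (m - n) (n + 1) ⬝ᵥ v) * ((-1) ^ n * (-1) ^ n * toepDet h m n) ∧
    (-1) ^ n * toepDet h m n * v 0 = v (Fin.last n) * toepDet h (m + 1) n := by
  have hlast : rowDet (Fin.cons (Pi.single (Fin.last n) 1) (rowBlock h m n (n + 1)) :
      Fin (n + 1) → Fin (n + 1) → R) = (-1) ^ n * toepDet h m n := by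
    have h1 := rowDet_snoc (rowBlock h m n (n + 1)) (Pi.single (Fin.last n) 1)
    rw [rowDet_snoc_single_last] at h1
    have h2 : toepDet h m n = rowDet fun i j => rowBlock h m n (n + 1) i (Fin.castSucc j) := rfl
    rw [h2, h1, ← mul_assoc, ← pow_add, Even.neg_one_pow ⟨n, rfl⟩, one_mul]
  have hfirst : rowDet (Fin.cons (Pi.single 0 1) (rowBlock h m n (n + 1)) :
      Fin (n + 1) → Fin (n + 1) → R) = toepDet h (m + 1) n := by
    rw [rowDet_cons_single_zero]
    simp only [rowBlock_succ]
    rfl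
  -- Three choices of the extra row `u`: the row starting at m + 1 extends the block upwards, the
  -- one starting at m - n extends it downwards after a cyclic permutation, and the last unit vector
  -- compares the end entries of `v`.
  refine ⟨?_, ?_, ?_⟩
  · have := det_mul_eq_of_orthogonal _ (shiftRow h (m + 1) (n + 1)) v hv (Fin.last n)
    change rowDet (Fin.cons _ (rowBlock h m n (n + 1)) : Fin (n + 1) → Fin (n + 1) → R) * _ =
      _ * rowDet (Fin.cons _ (rowBlock h m n (n + 1)) : Fin (n + 1) → Fin (n + 1) → R) at this
    rwa [hlast, cons_rowBlock h _ _ (by ring)] at this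
  · have := det_mul_eq_of_orthogonal _ (shiftRow h (m - n) (n + 1)) v hv (Fin.last n)
    change rowDet (Fin.cons _ (rowBlock h m n (n + 1)) : Fin (n + 1) → Fin (n + 1) → R) * _ =
      _ * rowDet (Fin.cons _ (rowBlock h m n (n + 1)) : Fin (n + 1) → Fin (n + 1) → R) at this
    rw [hlast] at this
    have h1 := rowDet_snoc (rowBlock h m n (n + 1)) (shiftRow h (m - n) (n + 1))
    rw [snoc_rowBlock h _ _ rfl] at h1
    have h2 : toepDet h m (n + 1) = rowDet (rowBlock h m (n + 1) (n + 1)) := rfl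
    rw [h2, h1, mul_assoc, this]
    ring
  · have := det_mul_eq_of_orthogonal _ (Pi.single (Fin.last n) 1) v hv 0
    change rowDet (Fin.cons _ (rowBlock h m n (n + 1)) : Fin (n + 1) → Fin (n + 1) → R) * _ =
      _ * rowDet (Fin.cons _ (rowBlock h m n (n + 1)) : Fin (n + 1) → Fin (n + 1) → R) at this
    rwa [hlast, hfirst, single_dotProduct, one_mul] at this

/-- The entries of the solution in the asymptotic formulas, in terms of Hermite determinants. -/
theorem IsRHPSolution.entries {m n : ℕ} (hn : 1 ≤ n) {x : ℂ}
    {N : ℂ → Matrix (Fin 2) (Fin 2) ℂ} {N₀ N₁ Nminus : Matrix (Fin 2) (Fin 2) ℂ}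
    (hN : IsRHPSolution m n x N) (h0 : ExpandsAtZero N N₀ N₁)
    (hinf : ExpandsAtInfinity n N Nminus) :
    (hermiteDet (m + 1) (n + 1)).eval (sqrtN m * x) * sqrtN n ^ n * sqrtN n ^ (m + 1) =
      2 * Real.pi * Complex.I * Nminus 0 1 * ((-1) ^ n * (hermiteDet m n).eval (sqrtN m * x)) ∧
    (hermiteDet m (n + 1)).eval (sqrtN m * x) * sqrtN n ^ m =
      -(2 * Real.pi * Complex.I * N₀ 0 1) * (hermiteDet m n).eval (sqrtN m * x) ∧
    (-1) ^ n * (hermiteDet m n).eval (sqrtN m * x) * N₀ 0 0 =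
      sqrtN n ^ n * (hermiteDet (m + 1) n).eval (sqrtN m * x) := by
  obtain ⟨a, ha1, ha0, P, hP, hl, hneg, hpos⟩ := hN.exists_orthogonal_polynomial h0 hinf
  have hn0 : n ≠ 0 := by omega
  have hc := sqrtN_ne_zero hn0
  set y := sqrtN m * x with hy
  set c := sqrtN n with hcdef
  set h : ℤ → ℂ := fun k => (hermiteCoeffInt k).eval y with hh
  -- Scaling the coefficients by c^i absorbs the powers of n^{1/2} in the moments that depend on i.
  set v : Fin (n + 1) → ℂ := fun i => a i * c ^ (i : ℕ) with hv
  have hint : ∀ k : ℤ, (∮ z in C(0, 1), z ^ k * P z) =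
      c ^ (k + m - n + 1) * (shiftRow h (k + m - n + 1) (n + 1) ⬝ᵥ v) := by
    intro k
    simp only [hP]
    rw [circleIntegral_weighted_polynomial hn0 x a k, Finset.sum_range]
    congr 1
    refine Finset.sum_congr rfl fun i _ => ?_
    simp only [shiftRow, hh, hv]
    ring
  have horth : ∀ i : Fin n, shiftRow h (m - (i : ℕ)) (n + 1) ⬝ᵥ v = 0 := by
    intro i
    -- Orthogonality to z^{n-1-i} concerns the moments starting at (n - 1 - i) + m - n + 1 = m - i.
    have h1 := hint ((n - 1 - i : ℕ) : ℤ)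
    rw [hl _ (by omega)] at h1
    have h2 := (mul_eq_zero.1 h1.symm).resolve_left (zpow_ne_zero _ hc)
    rw [← h2]
    congr 2
    omega
  obtain ⟨r1, r2, r3⟩ := toepDet_relations h m n v horth
  have hvlast : v (Fin.last n) = c ^ n := by simp [hv, ha1]
  have hv0 : v 0 = N₀ 0 0 := by simp [hv, ha0]
  have d1 : toepDet h (m + 1) (n + 1) = (hermiteDet (m + 1) (n + 1)).eval y := toepDet_eval _ _ _
  have d2 : toepDet h m n = (hermiteDet m n).eval y := toepDet_eval _ _ _
  have d3 : toepDet h m (n + 1) = (hermiteDet m (n + 1)).eval y := toepDet_eval _ _ _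
  have d4 : toepDet h (m + 1) n = (hermiteDet (m + 1) n).eval y := toepDet_eval _ _ _
  rw [hvlast, d1, d2] at r1
  rw [hvlast, d2, d3, ← pow_add, Even.neg_one_pow ⟨n, rfl⟩, one_mul] at r2
  rw [hvlast, hv0, d2, d4] at r3
  have i1 := hint n
  rw [hpos, show (n : ℤ) + m - n + 1 = m + 1 by ring] at i1
  have i2 := hint (-1)
  rw [hneg, show (-1 : ℤ) + m - n + 1 = m - n by ring, zpow_sub₀ hc, zpow_natCast,
    zpow_natCast] at i2
  refine ⟨?_, ?_, r3⟩
  · have e : c ^ ((m : ℤ) + 1) = c ^ (m + 1) := by exact_mod_cast zpow_natCast c (m + 1)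
    rw [i1, r1, e]
    ring
  · rw [i2]
    field_simp
    linear_combination r2

theorem wII_sub_wI {m n : ℕ} {y : ℂ} (hA : (hermiteDet m (n + 1)).eval y ≠ 0)
    (hC : (hermiteDet (m + 1) (n + 1)).eval y ≠ 0) (hF : (hermiteDet (m + 1) (n + 2)).eval y ≠ 0) :
    wII (m + 1) (n + 1) y = wI m (n + 1) y -
      2 * (hermiteDet (m + 1) (n + 1)).eval y * (hermiteDet m (n + 2)).eval y /
        ((hermiteDet m (n + 1)).eval y * (hermiteDet (m + 1) (n + 2)).eval y) := by
  have h := congrArg (eval y) (wronskian_diag m n)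
  simp only [eval_mul, eval_sub, eval_ofNat] at h
  rw [wI_eq (by exact_mod_cast hC) hA, wII_eq (by exact_mod_cast hF) (by exact_mod_cast hC), ← h]
  push_cast
  unfold polyLogDeriv
  field_simp
  ring

theorem wII_eq_wI_add {m n : ℕ} (hn : 1 ≤ n) {x : ℂ}
    (hC : (genHermite (m + 1) n).eval (sqrtN m * x) ≠ 0)
    (hF : (genHermite (m + 1) (n + 1)).eval (sqrtN m * x) ≠ 0)
    {N : ℂ → Matrix (Fin 2) (Fin 2) ℂ} {N₀ N₁ Nminus : Matrix (Fin 2) (Fin 2) ℂ}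
    (hN : IsRHPSolution m n x N) (h0 : ExpandsAtZero N N₀ N₁)
    (hinf : ExpandsAtInfinity n N Nminus) :
    (genHermite m n).eval (sqrtN m * x) ≠ 0 ∧ Nminus 0 1 ≠ 0 ∧
      1 / sqrtN n * wII (m + 1) n (sqrtN m * x) =
        1 / sqrtN n * wI m n (sqrtN m * x) + 2 * N₀ 0 0 * N₀ 0 1 / Nminus 0 1 := by
  rw [genHermite_eval_ne_zero_iff] at *
  push_cast at hC hF
  obtain ⟨e1, e2, e3⟩ := hN.entries hn h0 hinf
  have hc := sqrtN_ne_zero (k := n) (by omega)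
  have hpi : (2 * Real.pi * Complex.I : ℂ) ≠ 0 := Complex.two_pi_I_ne_zero
  -- Since τ_{m+1,n+1} does not vanish, the first entry relation forces both τ_{m,n} and `Nminus 0
  -- 1` to be nonzero.
  have hne : 2 * Real.pi * Complex.I * Nminus 0 1 *
      ((-1) ^ n * (hermiteDet m n).eval (sqrtN m * x)) ≠ 0 := by
    rw [← e1]
    exact mul_ne_zero (mul_ne_zero hF (pow_ne_zero _ hc)) (pow_ne_zero _ hc)
  have hA := right_ne_zero_of_mul (right_ne_zero_of_mul hne)
  have hNm := right_ne_zero_of_mul (left_ne_zero_of_mul hne)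
  refine ⟨hA, hNm, ?_⟩
  obtain ⟨k, rfl⟩ : ∃ k, n = k + 1 := ⟨n - 1, by omega⟩
  rw [wII_sub_wI hA hC hF]
  simp only [show k + 1 + 1 = k + 2 from rfl] at *
  generalize (hermiteDet (m : ℤ) (k + 1)).eval (sqrtN m * x) = A at *
  generalize (hermiteDet (m : ℤ) (k + 2)).eval (sqrtN m * x) = B at *
  generalize (hermiteDet ((m : ℤ) + 1) (k + 1)).eval (sqrtN m * x) = C at *
  generalize (hermiteDet ((m : ℤ) + 1) (k + 2)).eval (sqrtN m * x) = F at *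
  generalize sqrtN (k + 1) = c at *
  generalize Nminus 0 1 = M at *
  generalize N₀ 0 0 = a at *
  generalize N₀ 0 1 = b at *
  generalize wI m (k + 1) (sqrtN m * x) = w
  have hs : ((-1 : ℂ) ^ (k + 1)) * (-1) ^ (k + 1) = 1 := by
    rw [← pow_add, Even.neg_one_pow ⟨k + 1, rfl⟩]
  -- The identity between the last term of the bracket and the quotient in `wII_sub_wI`, with
  -- denominators cleared; it is the three entry relations combined, up to the nonzero factor `hnz`.
  have key : a * b * (A * F) * c = -(C * B * M) := by
    generalize (-1 : ℂ) ^ (k + 1) = s at *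
    have hs0 : s ≠ 0 := by rintro rfl; simp at hs
    have hnz : (2 * Real.pi * Complex.I : ℂ) * A * s * c ^ (k + 1) * c ^ m ≠ 0 := by
      simp only [ne_eq, mul_eq_zero, not_or]
      exact ⟨⟨⟨⟨by simp, hA⟩, hs0⟩, pow_ne_zero _ hc⟩, pow_ne_zero _ hc⟩
    apply mul_left_cancel₀ hnz
    linear_combination
      (2 * Real.pi * Complex.I * b * A) * (F * c ^ (k + 1) * c ^ (m + 1)) * e3
      + c ^ (k + 1) * C * (F * c ^ (k + 1) * c ^ (m + 1)) * e2
      - c ^ (k + 1) * C * (B * c ^ m) * e1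
  field_simp
  linear_combination -2 * key

end ExactFormula

end

theorem lemma3 :
    -- (a) the asymptotic formula, as `m, n → ∞` with `m / n = p / q` and `x` fixed
    (∀ (p q : ℕ), 1 ≤ q → q ≤ p → ∀ x : ℂ, InPoleFreeRegion p q x →
      ∃ (K : ℝ) (J : ℕ), ∀ j : ℕ, J ≤ j → ∀ m n : ℕ, m = j * p → n = j * q →
        ∀ (N : ℂ → Matrix (Fin 2) (Fin 2) ℂ) (N₀ N₁ Nminus : Matrix (Fin 2) (Fin 2) ℂ),
          IsRHPSolution m n x N → ExpandsAtZero N N₀ N₁ → ExpandsAtInfinity n N Nminus →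
          (genHermite m n).eval (sqrtN m * x) ≠ 0 ∧
          (genHermite (m + 1) n).eval (sqrtN m * x) ≠ 0 ∧
          Nminus 0 1 ≠ 0 ∧
          ∃ ε : ℂ, ‖ε‖ ≤ K / (m : ℝ) ∧
            1 / sqrtN n * wII (m + 1) n (sqrtN (m + 1) * x) =
              (1 / sqrtN n * wI m n (sqrtN m * x) + 2 * N₀ 0 0 * N₀ 0 1 / Nminus 0 1) * (1 + ε)) ∧
    -- (b) the bracket on the right is exactly the function of the second type at `m^{1/2} x`,
    -- wherever it is finite
    (∀ (m n : ℕ), 1 ≤ n → n ≤ m → ∀ x : ℂ,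
      (genHermite (m + 1) n).eval (sqrtN m * x) ≠ 0 →
      (genHermite (m + 1) (n + 1)).eval (sqrtN m * x) ≠ 0 →
        ∀ (N : ℂ → Matrix (Fin 2) (Fin 2) ℂ) (N₀ N₁ Nminus : Matrix (Fin 2) (Fin 2) ℂ),
          IsRHPSolution m n x N → ExpandsAtZero N N₀ N₁ → ExpandsAtInfinity n N Nminus →
          (genHermite m n).eval (sqrtN m * x) ≠ 0 ∧
          Nminus 0 1 ≠ 0 ∧
            1 / sqrtN n * wII (m + 1) n (sqrtN m * x) =
              1 / sqrtN n * wI m n (sqrtN m * x) + 2 * N₀ 0 0 * N₀ 0 1 / Nminus 0 1) := by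
  constructor
  · intro p q hq hqp x hx
    obtain ⟨K, J, hJ1, h⟩ := exists_wII_ratio_estimate hq hqp hx
    refine ⟨K, J, fun j hj m n hm hn N N₀ N₁ Nminus hN h0 hinf => ?_⟩
    obtain ⟨hC, hF, ε, hε, hw⟩ := h j hj m n hm hn
    have hn1 : 1 ≤ n := by rw [hn]; exact Nat.mul_pos (by omega) hq
    obtain ⟨hA, hM, hb⟩ := wII_eq_wI_add hn1 hC hF hN h0 hinf
    refine ⟨hA, hC, hM, ε, hε, ?_⟩
    rw [hw, ← hb, mul_assoc]
  · intro m n hn _ x hC hF N N₀ N₁ Nminus hN h0 hinf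
    exact wII_eq_wI_add hn hC hF hN h0 hinf
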